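/- Let $M$ be a connected, second countable, Hausdorff smooth manifold of dimension $n\ge 2$ and let $F:TM\to\mathbb R$ be a Finsler function: $F$ is smooth on the slit tangent manifold $\mathring TM$ of nonzero tangent vectors, $F(\lambda v)=\lambda F(v)$ for all $v\in TM$ and $\lambda\ge 0$, and the metric tensor $g=\frac12\nabla^{v}\nabla^{v}F^2$ is fibrewise non-degenerate on $\mathring TM$. Here tensors act on sections $X,Y,Z,U$ of the pull-back bundle $\mathring TM\times_M TM\to\mathring TM$, $\delta(v)=(v,v)$ is its canonical section, $\mathbf i$ is the canonical injection of sections into vertical vector fields, $\mathbf j$ the canonical surjection of vector fields on $\mathring TM$ onto sections, $\mathbf J=\mathbf i\circ\mathbf j$, $\nabla^{v}_XY=\mathbf j[\mathbf iX,\eta]$ for any $\eta$ with $\mathbf j\eta=Y$, and $(\nabla^{v}f)(X)=(\mathbf iX)f$. Covariant differentials of tensors are formed by the Leibniz rule, with the direction of differentiation as first argument. Let $E=\frac12F^2$, let $S$ be the canonical spray, determined on $\mathring TM$ by $i_S\,dd_{\mathbf J}E=-dE$ (where $d_{\mathbf J}E=dE\circ\mathbf J$), let $\mathcal H$ be the Ehresmann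 connection with $\mathcal H\widehat W=\frac12(W^{c}+[W^{v},S])$ for vector fields $W$ on $M$ (where $\widehat W$, $W^c$, $W^v$ are the basic section, the complete lift and the vertical lift of $W$), let $\mathcal V=\mathbf i^{-1}\circ(1-\mathcal H\circ\mathbf j)$, $\nabla^{h}_XY=\mathcal V[\mathcal HX,\mathbf iY]$, and let $\nabla_\xi Y=\nabla^{v}_{\mathcal V\xi}Y+\nabla^{h}_{\mathbf j\xi}Y$ be the Berwald derivative, with curvature $R^\nabla$. Put $$\mathbf B(X,Y)Z=R^\nabla(\mathbf iX,\mathcal HY)Z,\qquad \mathbf H(X,Y)Z=R^\nabla(\mathcal HX,\mathcal HY)Z,\qquad \mathbf P=-\tfrac12\nabla^{h}g,$$ $$\tfrac12\Sigma(X,Y,Z,U)=(\nabla^{h}\mathbf P)(X,Y,Z,U)-(\nabla^{h}\mathbf P)(Y,X,Z,U),\qquad \mathbf pX=X-\frac{g(X,\delta)}{g(\delta,\delta)}\,\delta.$$ The Finsler manifold $(M,F)$ is called p-Berwald if its projected Berwald curvature vanishes, i.e. $\mathbf p\bigl(\mathbf B(\mathbf pX,\mathbf pY)\mathbf pZ\bigr)=0$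 for all $X,Y,Z$; it is called R-quadratic if $\nabla^{v}\mathbf H=0$; $\Sigma$ is its stretch tensor. **Proposition.** Let $(M,F)$ be a p-Berwald Finsler manifold. Then $(M,F)$ is R-quadratic if and only if its stretch tensor $\Sigma$ vanishes. Moreover, for all sections $X,Y,Z,U$, $$(\nabla^{v}\mathbf H)(X,Y,Z,U)=\frac1{F^2}\,\Sigma(Z,Y,X,U)\,\delta .$$ -/

import Mathlib

open scoped Manifold ContDiff

noncomputable section

namespace Finsler

/-! ## Geometry along the slit tangent bundle of a chart domain

A chart with image `U ⊆ V` identifies the tangent bundle over its domain with `U × V`; a point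
`q = (x, y)` of `V × V` stands for the tangent vector `y` at `x`. Vector fields on the tangent
manifold become maps `V × V → V × V`, sections of the pull-back bundle (vector fields along the
projection) become maps `V × V → V`. All the operations below are local, and are used only at
points of the open set `slit U`, for data which are smooth on `slit U`. -/

section Local

variable {V : Type*} [NormedAddCommGroup V] [NormedSpace ℝ V]

/-- The slit tangent bundle over `U`: nonzero tangent vectors with base point in `U`. -/
def slit (U : Set V) : Set (V × V) := {q | q.1 ∈ U ∧ q.2 ≠ 0}

/-- Smooth sections of the pull-back bundle over the slit tangent bundle of `U`. -/
def SmoothSection (U : Set V) (X : V × V → V) : Prop := ContDiffOn ℝ ∞ X (slit U)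

/-- The canonical section `δ : v ↦ (v, v)`. -/
def canonicalSection : V × V → V := fun q => q.2

/-- The canonical injection `𝐢` of sections into the vertical vector fields. -/
def vert (X : V × V → V) : V × V → V × V := fun q => (0, X q)

/-- The canonical surjection `𝐣` of vector fields on the tangent manifold onto sections
(in each point the derivative of the projection). -/
def proj (ξ : V × V → V × V) : V × V → V := fun q => (ξ q).1

/-- The derivative `ξ f` of a function along a vector field on the tangent manifold. -/
def along (ξ : V × V → V × V) (f : V × V → ℝ) : V × V → ℝ := fun q => fderiv ℝ f q (ξ q)

/-- The vertical endomorphism `𝐉 = 𝐢 ∘ 𝐣`. -/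
def vertEndo : V × V →L[ℝ] V × V :=
  (ContinuousLinearMap.inr ℝ V V).comp (ContinuousLinearMap.fst ℝ V V)

/-- The vertical lift of a vector field on the base. -/
def vertLift (X : V → V) : V × V → V × V := fun q => (0, X q.1)

/-- The complete lift of a vector field on the base. -/
def completeLift (X : V → V) : V × V → V × V := fun q => (X q.1, fderiv ℝ X q.1 q.2)

/-- The vertical differential `∇ᵛ_X Y = 𝐣 [𝐢 X, η]` of a section, where `𝐣 η = Y`. The result does
not depend on `η`; here `η = (Y, 0)`. -/
def vDeriv (X Y : V × V → V) : V × V → V :=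
  proj (VectorField.lieBracket ℝ (vert X) (fun q => (Y q, 0)))

/-- The vertical differential `(∇ᵛ f)(X) = (𝐢 X) f` of a function. -/
def vDiff (f : V × V → ℝ) (X : V × V → V) : V × V → ℝ := along (vert X) f

/-- The second vertical differential
`(∇ᵛ ∇ᵛ f)(X, Y) = (𝐢 X)(∇ᵛ f (Y)) - ∇ᵛ f (∇ᵛ_X Y)` of a function. -/
def vDiff₂ (f : V × V → ℝ) (X Y : V × V → V) : V × V → ℝ :=
  fun q => along (vert X) (vDiff f Y) q - vDiff f (vDeriv X Y) q

/-! ### The Berwald derivative of a semispray -/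

/-- The Ehresmann connection associated to a semispray `S`: the fibrewise linear map `𝓗` with
`𝓗 (X̂) = ½ (Xᶜ + [Xᵛ, S])`, where `X` is a vector field on the base. Its value at the tangent
vector `q` and at `w` is computed with the vector field `X` of constant components `w`. -/
def hor (S : V × V → V × V) (q : V × V) (w : V) : V × V :=
  (1 / 2 : ℝ) • (completeLift (fun _ => w) q +
    VectorField.lieBracket ℝ (vertLift fun _ => w) S q)

/-- The formula `𝓗 (X̂) = ½ (Xᶜ + [Xᵛ, S])` for arbitrary vector fields `X` on the base. -/
theorem hor_apply (S : V × V → V × V) (q : V × V) (X : V → V)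
    (hX : DifferentiableAt ℝ X q.1) (hS : (S q).1 = q.2) :
    hor S q (X q.1) =
      (1 / 2 : ℝ) • (completeLift X q + VectorField.lieBracket ℝ (vertLift X) S q) := by
  have h1 : HasFDerivAt (vertLift X) ((ContinuousLinearMap.inr ℝ V V).comp
      ((fderiv ℝ X q.1).comp (ContinuousLinearMap.fst ℝ V V))) q := by
    have h2 : HasFDerivAt (fun p : V × V => X p.1)
        ((fderiv ℝ X q.1).comp (ContinuousLinearMap.fst ℝ V V)) q :=
      hX.hasFDerivAt.comp q hasFDerivAt_fst
    exact (ContinuousLinearMap.inr ℝ V V).hasFDerivAt.comp q h2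
  have h3 : HasFDerivAt (vertLift fun _ : V => X q.1) (0 : V × V →L[ℝ] V × V) q :=
    hasFDerivAt_const _ q
  simp only [hor, VectorField.lieBracket, h1.fderiv, h3.fderiv, completeLift, vertLift]
  congr 1
  ext <;> simp [hS]

/-- `𝓗 X` for a section `X`. -/
def horLift (S : V × V → V × V) (X : V × V → V) : V × V → V × V := fun q => hor S q (X q)

/-- The vertical map `𝓥 = 𝐢⁻¹ ∘ 𝐯`, where `𝐯 = 1 - 𝓗 ∘ 𝐣`. -/
def vertMap (S : V × V → V × V) (ξ : V × V → V × V) : V × V → V :=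
  fun q => (ξ q - hor S q (proj ξ q)).2

/-- The h-Berwald differential `∇ʰ_X Y = 𝓥 [𝓗 X, 𝐢 Y]` of a section. -/
def hDeriv (S : V × V → V × V) (X Y : V × V → V) : V × V → V :=
  vertMap S (VectorField.lieBracket ℝ (horLift S X) (vert Y))

/-- The Berwald derivative `∇_ξ Y = ∇ᵛ_{𝓥 ξ} Y + ∇ʰ_{𝐣 ξ} Y`. -/
def berwaldDeriv (S : V × V → V × V) (ξ : V × V → V × V) (Y : V × V → V) : V × V → V :=
  fun q => vDeriv (vertMap S ξ) Y q + hDeriv S (proj ξ) Y q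

/-- The curvature of the Berwald derivative,
`R(ξ, η) Z = ∇_ξ ∇_η Z - ∇_η ∇_ξ Z - ∇_[ξ, η] Z`. -/
def berwaldDerivCurvature (S : V × V → V × V) (ξ η : V × V → V × V) (Z : V × V → V) :
    V × V → V :=
  fun q => berwaldDeriv S ξ (berwaldDeriv S η Z) q - berwaldDeriv S η (berwaldDeriv S ξ Z) q -
    berwaldDeriv S (VectorField.lieBracket ℝ ξ η) Z q

/-- The Berwald curvature `𝐁(X, Y) Z = R(𝐢 X, 𝓗 Y) Z`. -/
def berwaldCurvature (S : V × V → V × V) (X Y Z : V × V → V) : V × V → V :=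
  berwaldDerivCurvature S (vert X) (horLift S Y) Z

/-- The affine curvature `𝐇(X, Y) Z = R(𝓗 X, 𝓗 Y) Z`. -/
def affineCurvature (S : V × V → V × V) (X Y Z : V × V → V) : V × V → V :=
  berwaldDerivCurvature S (horLift S X) (horLift S Y) Z

/-- The vertical differential of the affine curvature,
`(∇ᵛ 𝐇)(X, Y, Z, U) = (∇ᵛ_X 𝐇)(Y, Z) U`. -/
def vDerivAffineCurvature (S : V × V → V × V) (X Y Z U : V × V → V) : V × V → V :=
  fun q => vDeriv X (affineCurvature S Y Z U) q - affineCurvature S (vDeriv X Y) Z U q -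
    affineCurvature S Y (vDeriv X Z) U q - affineCurvature S Y Z (vDeriv X U) q

/-- The h-Berwald differential `(∇ʰ A)(X, Y, Z) = (∇ʰ_X A)(Y, Z)` of a type `(0, 2)` tensor. -/
def hDeriv₂ (S : V × V → V × V) (A : (V × V → V) → (V × V → V) → V × V → ℝ)
    (X Y Z : V × V → V) : V × V → ℝ :=
  fun q => along (horLift S X) (A Y Z) q - A (hDeriv S X Y) Z q - A Y (hDeriv S X Z) q

/-- The h-Berwald differential `(∇ʰ A)(X, Y, Z, U) = (∇ʰ_X A)(Y, Z, U)` of a type `(0, 3)`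
tensor. -/
def hDeriv₃ (S : V × V → V × V) (A : (V × V → V) → (V × V → V) → (V × V → V) → V × V → ℝ)
    (X Y Z U : V × V → V) : V × V → ℝ :=
  fun q => along (horLift S X) (A Y Z U) q - A (hDeriv S X Y) Z U q -
    A Y (hDeriv S X Z) U q - A Y Z (hDeriv S X U) q

/-! ### The tensors of a Finsler function `L : (x, y) ↦ L (x, y)` -/

/-- The energy `E = ½ L²`. -/
def energy (L : V × V → ℝ) : V × V → ℝ := fun q => 1 / 2 * L q ^ 2

/-- The metric tensor `g = ½ ∇ᵛ ∇ᵛ L²`. -/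
def metric (L : V × V → ℝ) (X Y : V × V → V) : V × V → ℝ :=
  fun q => 1 / 2 * vDiff₂ (fun p => L p ^ 2) X Y q

/-- The 1-form `d_𝐉 E = dE ∘ 𝐉`. -/
def dJE (L : V × V → ℝ) : V × V → (V × V →L[ℝ] ℝ) :=
  fun q => (fderiv ℝ (energy L) q).comp vertEndo

/-- The 2-form `d d_𝐉 E`, that is, `(a, b) ↦ (D_a (d_𝐉 E))(b) - (D_b (d_𝐉 E))(a)`, in curried
form. -/
def ddJE (L : V × V → ℝ) : V × V → (V × V →L[ℝ] V × V →L[ℝ] ℝ) :=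
  fun q => fderiv ℝ (dJE L) q - (fderiv ℝ (dJE L) q).flip

/-- The canonical spray: zero on the zero section, and at a nonzero tangent vector the solution
`S` of `i_S d d_𝐉 E = - dE` (the 2-form `d d_𝐉 E` is non-degenerate there, so it can be
inverted). -/
def canonicalSpray (L : V × V → ℝ) : V × V → V × V :=
  open Classical in
  fun q => if q.2 = 0 then 0
    else ContinuousLinearMap.inverse (ddJE L q) (-(fderiv ℝ (energy L) q))

/-- The Landsberg tensor `𝐏 = - ½ ∇ʰ g`. -/
def landsberg (L : V × V → ℝ) (X Y Z : V × V → V) : V × V → ℝ :=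
  fun q => -(1 / 2) * hDeriv₂ (canonicalSpray L) (metric L) X Y Z q

/-- The stretch tensor `Σ`, with `½ Σ(X, Y, Z, U) = (∇ʰ 𝐏)(X, Y, Z, U) - (∇ʰ 𝐏)(Y, X, Z, U)`. -/
def stretch (L : V × V → ℝ) (X Y Z U : V × V → V) : V × V → ℝ :=
  fun q => 2 * (hDeriv₃ (canonicalSpray L) (landsberg L) X Y Z U q -
    hDeriv₃ (canonicalSpray L) (landsberg L) Y X Z U q)

/-- The orthogonal projection `𝐩 X = X - (g(X, δ) / g(δ, δ)) δ` along the canonical section. -/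
def orthProj (L : V × V → ℝ) (X : V × V → V) : V × V → V :=
  fun q => X q - (metric L X canonicalSection q /
    metric L canonicalSection canonicalSection q) • canonicalSection q

/-- The projected Berwald curvature `(X, Y, Z) ↦ 𝐩 (𝐁(𝐩 X, 𝐩 Y) 𝐩 Z)`. -/
def projectedBerwaldCurvature (L : V × V → ℝ) (X Y Z : V × V → V) : V × V → V :=
  orthProj L (berwaldCurvature (canonicalSpray L) (orthProj L X) (orthProj L Y) (orthProj L Z))

end Local

/-! ## Finsler manifolds -/

section Manifold

variable {V : Type*} [NormedAddCommGroup V] [NormedSpace ℝ V]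
  {M : Type*} [TopologicalSpace M] [ChartedSpace V M] [IsManifold 𝓘(ℝ, V) ∞ M]

/-- The expression `(x, y) ↦ F (y as a tangent vector at x)` of a function on the tangent
manifold in the chart induced by a chart `e` of the base. -/
def inChart (F : TangentBundle 𝓘(ℝ, V) M → ℝ) (e : OpenPartialHomeomorph M V) : V × V → ℝ :=
  fun q => F ⟨e.symm q.1, mfderiv 𝓘(ℝ, V) 𝓘(ℝ, V) e.symm q.1 q.2⟩

/-- Finsler functions: smooth on the slit tangent manifold, positive-homogeneous of degree `1`,
with fibrewise non-degenerate metric tensor. -/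
structure IsFinslerFunction (F : TangentBundle 𝓘(ℝ, V) M → ℝ) : Prop where
  smooth : ContMDiffOn 𝓘(ℝ, V).tangent 𝓘(ℝ, ℝ) ∞ F {v | v.2 ≠ 0}
  homogeneous : ∀ (p : M) (w : TangentSpace 𝓘(ℝ, V) p) (c : ℝ), 0 ≤ c →
    F ⟨p, c • w⟩ = c * F ⟨p, w⟩
  nondegenerate : ∀ e ∈ IsManifold.maximalAtlas 𝓘(ℝ, V) ∞ M, ∀ q ∈ slit e.target, ∀ w : V,
    (∀ u : V, metric (inChart F e) (fun _ => w) (fun _ => u) q = 0) → w = 0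

/-- The projected Berwald curvature vanishes. -/
def IsPBerwald (F : TangentBundle 𝓘(ℝ, V) M → ℝ) : Prop :=
  ∀ e ∈ IsManifold.maximalAtlas 𝓘(ℝ, V) ∞ M, ∀ X Y Z : V × V → V,
    SmoothSection e.target X → SmoothSection e.target Y → SmoothSection e.target Z →
    ∀ q ∈ slit e.target, projectedBerwaldCurvature (inChart F e) X Y Z q = 0

/-- The vertical differential `∇ᵛ 𝐇` of the affine curvature of the canonical connection
vanishes. -/
def IsRQuadratic (F : TangentBundle 𝓘(ℝ, V) M → ℝ) : Prop :=
  ∀ e ∈ IsManifold.maximalAtlas 𝓘(ℝ, V) ∞ M, ∀ X Y Z U : V × V → V,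
    SmoothSection e.target X → SmoothSection e.target Y → SmoothSection e.target Z →
    SmoothSection e.target U →
    ∀ q ∈ slit e.target,
      vDerivAffineCurvature (canonicalSpray (inChart F e)) X Y Z U q = 0

/-- The stretch tensor vanishes. -/
def HasVanishingStretch (F : TangentBundle 𝓘(ℝ, V) M → ℝ) : Prop :=
  ∀ e ∈ IsManifold.maximalAtlas 𝓘(ℝ, V) ∞ M, ∀ X Y Z U : V × V → V,
    SmoothSection e.target X → SmoothSection e.target Y → SmoothSection e.target Z →
    SmoothSection e.target U →
    ∀ q ∈ slit e.target, stretch (inChart F e) X Y Z U q = 0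

end Manifold

end Finsler

end

noncomputable section

set_option maxSynthPendingDepth 3

namespace Finsler

section Local

variable {V : Type*} [NormedAddCommGroup V] [NormedSpace ℝ V]
  {W : Type*} [NormedAddCommGroup W] [NormedSpace ℝ W]

/-! In a chart the canonical spray is `(y, -2G)`, and the Berwald derivative is the flat derivative
corrected by `G_yy`. Hence `𝐁` is the totally symmetric tensor `G_yyy`. Since vertical and
horizontal derivatives of `G_yy` commute up to connection terms, a Bianchi-type identity holds
(`vDerivAffineCurvature_eq`): `(∇ᵛ𝐇)(X, Y, Z, U) = (∇ʰ𝐁)(Y, X, Z, U) - (∇ʰ𝐁)(Z, X, Y, U)`.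

The Finsler structure enters through three horizontally parallel objects: the energy `E`, the form
`θ = g(δ, ·) = E_y`, and `δ` itself. Differentiating the parallelism of `θ` in the fibre gives `𝐏(X,
Y, Z) = -½ θ(𝐁(X, Y)Z)` (`landsberg_apply`). Differentiating this horizontally and comparing with
the identity above gives `Σ(Z, Y, X, U) = θ((∇ᵛ𝐇)(X, Y, Z, U))` (`stretch_apply`). None of this uses
the p-Berwald condition.

Because `𝐁` vanishes as soon as one argument is `δ`, projecting the arguments changes nothing, so
p-Berwald means `F² 𝐁 = θ(𝐁) δ`. As `F²`, `θ` and `δ` are parallel, `∇ʰ𝐁` satisfies the same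
relation (`berwaldTensorDeriv_eq_of_projected`), hence so does `∇ᵛ𝐇`. This is the asserted formula,
and the equivalence follows since `F` has no zeros on nonzero vectors (`ne_zero`). -/

omit [NormedSpace ℝ V] in
theorem isOpen_slit {U : Set V} (hU : IsOpen U) : IsOpen (slit U) :=
  (hU.preimage continuous_fst).inter (isOpen_ne.preimage continuous_snd)

/-! ### Derivatives in the fibre directions -/

/-- The derivative of a function of `(x, y)` with respect to `y`. -/
def fiberDeriv (f : V × V → W) : V × V → V →L[ℝ] W :=
  fun q => (fderiv ℝ f q).comp (ContinuousLinearMap.inr ℝ V V)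

theorem fiberDeriv_apply (f : V × V → W) (q : V × V) (w : V) :
    fiberDeriv f q w = fderiv ℝ f q (0, w) := rfl

theorem smoothOn_fderiv {A : Type*} [NormedAddCommGroup A] [NormedSpace ℝ A]
    {O : Set A} (hO : IsOpen O) {f : A → W} (hf : ContDiffOn ℝ ∞ f O) :
    ContDiffOn ℝ ∞ (fderiv ℝ f) O :=
  hf.fderiv_of_isOpen hO (by simp)

variable {O : Set (V × V)}

theorem smoothOn_fiberDeriv (hO : IsOpen O) {f : V × V → W} (hf : ContDiffOn ℝ ∞ f O) :
    ContDiffOn ℝ ∞ (fiberDeriv f) O :=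
  (smoothOn_fderiv hO hf).clm_comp contDiffOn_const

theorem _root_.ContDiffOn.diffAt {A : Type*} [NormedAddCommGroup A] [NormedSpace ℝ A]
    {O : Set A} {f : A → W} (hf : ContDiffOn ℝ ∞ f O) (hO : IsOpen O) {q : A} (hq : q ∈ O) :
    DifferentiableAt ℝ f q :=
  (hf.contDiffAt (hO.mem_nhds hq)).differentiableAt (by simp)

theorem fderiv_congr_on {A : Type*} [NormedAddCommGroup A] [NormedSpace ℝ A]
    {O : Set A} (hO : IsOpen O) {f f' : A → W} (h : ∀ q ∈ O, f q = f' q) {q : A} (hq : q ∈ O) :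
    fderiv ℝ f q = fderiv ℝ f' q :=
  Filter.EventuallyEq.fderiv_eq (Filter.eventually_of_mem (hO.mem_nhds hq) h)

theorem fderiv_fderiv_comm {A : Type*} [NormedAddCommGroup A] [NormedSpace ℝ A]
    {O : Set A} (hO : IsOpen O) {f : A → W} (hf : ContDiffOn ℝ ∞ f O) {q : A} (hq : q ∈ O)
    (a b : A) : fderiv ℝ (fderiv ℝ f) q a b = fderiv ℝ (fderiv ℝ f) q b a :=
  ((hf.contDiffAt (hO.mem_nhds hq)).isSymmSndFDerivAt
    (by simpa using WithTop.coe_le_coe.2 (le_top : (2 : ℕ∞) ≤ ⊤))).eq a b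

theorem fderiv_fiberDeriv (hO : IsOpen O) {f : V × V → W} (hf : ContDiffOn ℝ ∞ f O) {q : V × V}
    (hq : q ∈ O) (a : V × V) (w : V) :
    fderiv ℝ (fiberDeriv f) q a w = fderiv ℝ (fderiv ℝ f) q a (0, w) := by
  have h := ((smoothOn_fderiv hO hf).diffAt hO hq).hasFDerivAt.clm_comp
    (hasFDerivAt_const (ContinuousLinearMap.inr ℝ V V) q)
  have h' : fderiv ℝ (fiberDeriv f) q = _ := h.fderiv
  rw [h']
  simp

theorem fiberDeriv_fiberDeriv_comm (hO : IsOpen O) {f : V × V → W} (hf : ContDiffOn ℝ ∞ f O)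
    {q : V × V} (hq : q ∈ O) (v w : V) :
    fiberDeriv (fiberDeriv f) q v w = fiberDeriv (fiberDeriv f) q w v := by
  rw [fiberDeriv_apply, fiberDeriv_apply, fderiv_fiberDeriv hO hf hq, fderiv_fiberDeriv hO hf hq,
    fderiv_fderiv_comm hO hf hq]

/-- The derivative of `q ↦ A q (X q)`. -/
theorem fderiv_clm_apply_apply {A F G : Type*} [NormedAddCommGroup A] [NormedSpace ℝ A]
    [NormedAddCommGroup F] [NormedSpace ℝ F] [NormedAddCommGroup G] [NormedSpace ℝ G]
    {c : A → F →L[ℝ] G} {u : A → F} {q : A} (hc : DifferentiableAt ℝ c q)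
    (hu : DifferentiableAt ℝ u q) (a : A) :
    fderiv ℝ (fun p => c p (u p)) q a = fderiv ℝ c q a (u q) + c q (fderiv ℝ u q a) := by
  rw [fderiv_clm_apply hc hu]
  simp [add_comm]

theorem fderiv_const_apply {A F G : Type*} [NormedAddCommGroup A] [NormedSpace ℝ A]
    [NormedAddCommGroup F] [NormedSpace ℝ F] [NormedAddCommGroup G] [NormedSpace ℝ G]
    {c : A → F →L[ℝ] G} {q : A} (hc : DifferentiableAt ℝ c q) (u : F) (a : A) :
    fderiv ℝ (fun p => c p u) q a = fderiv ℝ c q a u := by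
  rw [fderiv_clm_apply_apply hc (differentiableAt_const u)]
  simp

/-! ### The Berwald connection of a semispray in coordinates -/

/-- The coefficients `G_y` of the Ehresmann connection of the semispray `(y, -2 G)`. -/
def connCoeff (S : V × V → V × V) : V × V → V →L[ℝ] V :=
  fun q => (-(1 / 2 : ℝ)) • fiberDeriv (fun p => (S p).2) q

/-- The coefficients `G_yy` of the Berwald connection of the semispray `(y, -2 G)`. -/
def berwaldCoeff (S : V × V → V × V) : V × V → V →L[ℝ] V →L[ℝ] V := fiberDeriv (connCoeff S)

/-- The components `G_yyy` of the Berwald curvature of the semispray `(y, -2 G)`. -/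
def berwaldTensor (S : V × V → V × V) : V × V → V →L[ℝ] V →L[ℝ] V →L[ℝ] V :=
  fiberDeriv (berwaldCoeff S)

/-- Semisprays which are smooth on an open set. -/
structure IsSemispray (O : Set (V × V)) (S : V × V → V × V) : Prop where
  isOpen : IsOpen O
  smooth : ContDiffOn ℝ ∞ S O
  fst_eq : ∀ q ∈ O, (S q).1 = q.2

namespace IsSemispray

variable {S : V × V → V × V} (hS : IsSemispray O S)

include hS

theorem smooth_snd : ContDiffOn ℝ ∞ (fun p => (S p).2) O := hS.smooth.snd

theorem smooth_connCoeff : ContDiffOn ℝ ∞ (connCoeff S) O :=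
  (smoothOn_fiberDeriv hS.isOpen hS.smooth_snd).const_smul _

theorem smooth_berwaldCoeff : ContDiffOn ℝ ∞ (berwaldCoeff S) O :=
  smoothOn_fiberDeriv hS.isOpen hS.smooth_connCoeff

theorem smooth_berwaldTensor : ContDiffOn ℝ ∞ (berwaldTensor S) O :=
  smoothOn_fiberDeriv hS.isOpen hS.smooth_berwaldCoeff

/-- The bracket of the constant vertical field with `S` is `(w, -2 G_y w)` and the complete lift of
a constant field is `(w, 0)`; the connection averages the two. -/
theorem hor_eq {q : V × V} (hq : q ∈ O) (w : V) : hor S q w = (w, -connCoeff S q w) := by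
  have h1 : fderiv ℝ S q (0, w) = (w, fderiv ℝ (fun p => (S p).2) q (0, w)) := by
    have hd := hS.smooth.diffAt hS.isOpen hq
    have h2 : fderiv ℝ (fun p => (S p).1) q = ContinuousLinearMap.snd ℝ V V := by
      rw [fderiv_congr_on hS.isOpen hS.fst_eq hq]
      exact fderiv_snd
    have e1 := DFunLike.congr_fun (fderiv.fst hd) (0, w)
    have e2 := DFunLike.congr_fun (fderiv.snd hd) (0, w)
    rw [h2] at e1
    ext
    · simpa using e1.symm
    · simpa using e2.symm
  have h3 : fderiv ℝ (vertLift fun _ : V => w) q = 0 := (hasFDerivAt_const _ q).fderiv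
  have h4 : fderiv ℝ (fun _ : V => w) q.1 = 0 := (hasFDerivAt_const _ _).fderiv
  simp only [hor, VectorField.lieBracket, completeLift, h3, h4]
  simp only [vertLift, h1, connCoeff, fiberDeriv_apply, _root_.smul_apply,
    _root_.zero_apply, sub_zero]
  ext
  · simp only [Prod.smul_fst, Prod.fst_add]
    module
  · simp only [Prod.smul_snd, Prod.snd_add]
    module

theorem berwaldCoeff_symm {q : V × V} (hq : q ∈ O) (v w : V) :
    berwaldCoeff S q v w = berwaldCoeff S q w v := by
  have h : berwaldCoeff S q = (-(1 / 2 : ℝ)) • fiberDeriv (fiberDeriv fun p => (S p).2) q := by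
    ext v w
    have hd := (smoothOn_fiberDeriv hS.isOpen hS.smooth_snd).diffAt hS.isOpen hq
    have := fderiv_const_smul hd (-(1 / 2 : ℝ))
    simp only [berwaldCoeff, fiberDeriv_apply, _root_.smul_apply]
    change fderiv ℝ (fun p => (-(1 / 2 : ℝ)) • fiberDeriv (fun p => (S p).2) p) q (0, v) w = _
    erw [this]
    rfl
  rw [h]
  simp only [_root_.smul_apply]
  rw [fiberDeriv_fiberDeriv_comm hS.isOpen hS.smooth_snd hq]

theorem berwaldTensor_symm_left {q : V × V} (hq : q ∈ O) (u v w : V) :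
    berwaldTensor S q u v w = berwaldTensor S q v u w := by
  rw [berwaldTensor, berwaldCoeff, fiberDeriv_fiberDeriv_comm hS.isOpen hS.smooth_connCoeff hq]

/-- The symmetry of `G_yy` holds on all of the open set `O`, so it may be differentiated in any
direction. For vertical directions this completes the total symmetry of `G_yyy`. -/
theorem fderiv_berwaldCoeff_symm {q : V × V} (hq : q ∈ O) (a : V × V) (v w : V) :
    fderiv ℝ (berwaldCoeff S) q a v w = fderiv ℝ (berwaldCoeff S) q a w v := by
  have hd := hS.smooth_berwaldCoeff.diffAt hS.isOpen hq
  have key : ∀ v w, fderiv ℝ (fun p => berwaldCoeff S p v w) q a =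
      fderiv ℝ (berwaldCoeff S) q a v w := fun v w => by
    rw [fderiv_const_apply (hd.clm_apply (differentiableAt_const v)), fderiv_const_apply hd]
  rw [← key, ← key, fderiv_congr_on hS.isOpen (fun p hp => hS.berwaldCoeff_symm hp v w) hq]

theorem berwaldTensor_symm_right {q : V × V} (hq : q ∈ O) (u v w : V) :
    berwaldTensor S q u v w = berwaldTensor S q u w v :=
  hS.fderiv_berwaldCoeff_symm hq (0, u) v w

theorem fderiv_berwaldTensor_apply {q : V × V} (hq : q ∈ O) (a : V × V) (u v w : V) :
    fderiv ℝ (fun p => berwaldTensor S p u v w) q a = fderiv ℝ (berwaldTensor S) q a u v w := by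
  have hd := hS.smooth_berwaldTensor.diffAt hS.isOpen hq
  rw [fderiv_const_apply ((hd.clm_apply (differentiableAt_const u)).clm_apply
    (differentiableAt_const v)), fderiv_const_apply (hd.clm_apply (differentiableAt_const u)),
    fderiv_const_apply hd]

theorem fderiv_berwaldTensor_symm_left {q : V × V} (hq : q ∈ O) (a : V × V) (u v w : V) :
    fderiv ℝ (berwaldTensor S) q a u v w = fderiv ℝ (berwaldTensor S) q a v u w := by
  rw [← hS.fderiv_berwaldTensor_apply hq, ← hS.fderiv_berwaldTensor_apply hq,
    fderiv_congr_on hS.isOpen (fun p hp => hS.berwaldTensor_symm_left hp u v w) hq]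

theorem smooth_horLift {X : V × V → V} (hX : ContDiffOn ℝ ∞ X O) :
    ContDiffOn ℝ ∞ (horLift S X) O :=
  (hX.prodMk (hS.smooth_connCoeff.clm_apply hX).neg).congr fun q hq => hS.hor_eq hq (X q)

/-- The bracket `[𝓗X, 𝐢Y]` contains the derivative of `X` along `𝐢Y`, but only as a horizontal
vector, which `𝓥` removes. What survives of the derivative of `𝓗X` is the fibre derivative of `G_y`.
-/
theorem hDeriv_eq {X Y : V × V → V} (hX : ContDiffOn ℝ ∞ X O) (hY : ContDiffOn ℝ ∞ Y O)
    {q : V × V} (hq : q ∈ O) :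
    hDeriv S X Y q = fderiv ℝ Y q (hor S q (X q)) + berwaldCoeff S q (X q) (Y q) := by
  have dX := (hX.diffAt hS.isOpen hq)
  have dY := (hY.diffAt hS.isOpen hq)
  have dN := hS.smooth_connCoeff.diffAt hS.isOpen hq
  have h1 : fderiv ℝ (vert Y) q = (fderiv ℝ (fun _ : V × V => (0 : V)) q).prod (fderiv ℝ Y q) :=
    (differentiableAt_const (0 : V)).fderiv_prodMk dY
  have h2 : fderiv ℝ (horLift S X) q =
      (fderiv ℝ X q).prod (fderiv ℝ (fun p => -connCoeff S p (X p)) q) := by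
    rw [fderiv_congr_on hS.isOpen (f := horLift S X) (f' := fun p => (X p, -connCoeff S p (X p)))
      (fun p hp => hS.hor_eq hp (X p)) hq]
    exact dX.fderiv_prodMk (dN.clm_apply dX).neg
  have h3 : fderiv ℝ (fun p => -connCoeff S p (X p)) q (0, Y q) =
      -(fderiv ℝ (connCoeff S) q (0, Y q) (X q) + connCoeff S q (fderiv ℝ X q (0, Y q))) := by
    rw [fderiv_fun_neg, _root_.neg_apply, fderiv_clm_apply_apply dN dX]
  simp only [hDeriv, vertMap, proj, VectorField.lieBracket, h1, h2, hS.hor_eq hq,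
    ContinuousLinearMap.prod_apply, vert, h3, horLift, fderiv_fun_const]
  rw [hS.berwaldCoeff_symm hq, berwaldCoeff, fiberDeriv_apply]
  simp
  abel

end IsSemispray

theorem vDeriv_eq {X Y : V × V → V} {q : V × V} (dX : DifferentiableAt ℝ X q)
    (dY : DifferentiableAt ℝ Y q) : vDeriv X Y q = fderiv ℝ Y q (0, X q) := by
  have h1 : fderiv ℝ (vert X) q = (fderiv ℝ (fun _ : V × V => (0 : V)) q).prod (fderiv ℝ X q) :=
    (differentiableAt_const (0 : V)).fderiv_prodMk dX
  have h2 : fderiv ℝ (fun p => (Y p, (0 : V))) q =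
      (fderiv ℝ Y q).prod (fderiv ℝ (fun _ : V × V => (0 : V)) q) :=
    dY.fderiv_prodMk (differentiableAt_const (0 : V))
  simp [vDeriv, proj, VectorField.lieBracket, h1, h2, vert]

theorem smooth_vDeriv (hO : IsOpen O) {X Y : V × V → V} (hX : ContDiffOn ℝ ∞ X O)
    (hY : ContDiffOn ℝ ∞ Y O) : ContDiffOn ℝ ∞ (vDeriv X Y) O :=
  ((smoothOn_fderiv hO hY).clm_apply (contDiffOn_const.prodMk hX)).congr fun _ hq =>
    vDeriv_eq (hX.diffAt hO hq) (hY.diffAt hO hq)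

namespace IsSemispray

variable {S : V × V → V × V} (hS : IsSemispray O S)

include hS

theorem smooth_hDeriv {X Y : V × V → V} (hX : ContDiffOn ℝ ∞ X O) (hY : ContDiffOn ℝ ∞ Y O) :
    ContDiffOn ℝ ∞ (hDeriv S X Y) O :=
  (((smoothOn_fderiv hS.isOpen hY).clm_apply (hS.smooth_horLift hX)).add
    ((hS.smooth_berwaldCoeff.clm_apply hX).clm_apply hY)).congr fun _ hq => hS.hDeriv_eq hX hY hq

/-- The vertical and horizontal parts of `ξ` recombine to `ξ` in the flat derivative, leaving one
Christoffel-type term. -/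
theorem berwaldDeriv_eq {ξ : V × V → V × V} {Y : V × V → V} (hξ : ContDiffOn ℝ ∞ ξ O)
    (hY : ContDiffOn ℝ ∞ Y O) {q : V × V} (hq : q ∈ O) :
    berwaldDeriv S ξ Y q = fderiv ℝ Y q (ξ q) + berwaldCoeff S q (ξ q).1 (Y q) := by
  have hv : ContDiffOn ℝ ∞ (vertMap S ξ) O :=
    (hξ.sub (hS.smooth_horLift hξ.fst)).snd
  rw [berwaldDeriv, vDeriv_eq (hv.diffAt hS.isOpen hq) (hY.diffAt hS.isOpen hq),
    hS.hDeriv_eq (X := proj ξ) hξ.fst hY hq, ← add_assoc, ← map_add, hS.hor_eq hq]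
  simp [vertMap, hS.hor_eq hq, proj]

theorem smooth_berwaldDeriv {ξ : V × V → V × V} {Y : V × V → V} (hξ : ContDiffOn ℝ ∞ ξ O)
    (hY : ContDiffOn ℝ ∞ Y O) : ContDiffOn ℝ ∞ (berwaldDeriv S ξ Y) O :=
  (((smoothOn_fderiv hS.isOpen hY).clm_apply hξ).add
    ((hS.smooth_berwaldCoeff.clm_apply hξ.fst).clm_apply hY)).congr
      fun _ hq => hS.berwaldDeriv_eq hξ hY hq

theorem berwaldDeriv_berwaldDeriv_eq {ξ η : V × V → V × V} {Z : V × V → V}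
    (hξ : ContDiffOn ℝ ∞ ξ O) (hη : ContDiffOn ℝ ∞ η O) (hZ : ContDiffOn ℝ ∞ Z O)
    {q : V × V} (hq : q ∈ O) :
    berwaldDeriv S ξ (berwaldDeriv S η Z) q =
      fderiv ℝ (fderiv ℝ Z) q (ξ q) (η q) + fderiv ℝ Z q (fderiv ℝ η q (ξ q)) +
      (fderiv ℝ (berwaldCoeff S) q (ξ q) (η q).1 (Z q) +
        berwaldCoeff S q (fderiv ℝ η q (ξ q)).1 (Z q) +
        berwaldCoeff S q (η q).1 (fderiv ℝ Z q (ξ q))) +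
      berwaldCoeff S q (ξ q).1 (fderiv ℝ Z q (η q)) +
      berwaldCoeff S q (ξ q).1 (berwaldCoeff S q (η q).1 (Z q)) := by
  have dZ := hZ.diffAt hS.isOpen hq
  have dZ' := (smoothOn_fderiv hS.isOpen hZ).diffAt hS.isOpen hq
  have dη := hη.diffAt hS.isOpen hq
  have dG := hS.smooth_berwaldCoeff.diffAt hS.isOpen hq
  have dη1 : DifferentiableAt ℝ (fun p => (η p).1) q := dη.fst
  have h1 : fderiv ℝ (fun p => (η p).1) q (ξ q) = (fderiv ℝ η q (ξ q)).1 := by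
    rw [fderiv.fst dη]; rfl
  rw [hS.berwaldDeriv_eq hξ (hS.smooth_berwaldDeriv hη hZ) hq,
    fderiv_congr_on hS.isOpen (fun p hp => hS.berwaldDeriv_eq hη hZ hp) hq,
    hS.berwaldDeriv_eq hη hZ hq,
    fderiv_fun_add (dZ'.clm_apply dη) ((dG.clm_apply dη1).clm_apply dZ),
    _root_.add_apply, fderiv_clm_apply_apply dZ' dη,
    fderiv_clm_apply_apply (dG.clm_apply dη1) dZ, fderiv_clm_apply_apply dG dη1, h1]
  simp only [map_add, _root_.add_apply]
  abel

/-- Second derivatives of `Z` cancel by symmetry, and derivatives of `ξ` and `η` cancel against the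
bracket term. The rest is the curvature of the connection form `ξ ↦ G_yy(𝐣ξ, ·)`. -/
theorem berwaldDerivCurvature_eq {ξ η : V × V → V × V} {Z : V × V → V}
    (hξ : ContDiffOn ℝ ∞ ξ O) (hη : ContDiffOn ℝ ∞ η O) (hZ : ContDiffOn ℝ ∞ Z O)
    {q : V × V} (hq : q ∈ O) :
    berwaldDerivCurvature S ξ η Z q =
      fderiv ℝ (berwaldCoeff S) q (ξ q) (η q).1 (Z q) -
      fderiv ℝ (berwaldCoeff S) q (η q) (ξ q).1 (Z q) +
      berwaldCoeff S q (ξ q).1 (berwaldCoeff S q (η q).1 (Z q)) -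
      berwaldCoeff S q (η q).1 (berwaldCoeff S q (ξ q).1 (Z q)) := by
  have hb : ContDiffOn ℝ ∞ (VectorField.lieBracket ℝ ξ η) O :=
    ((smoothOn_fderiv hS.isOpen hη).clm_apply hξ).sub
      ((smoothOn_fderiv hS.isOpen hξ).clm_apply hη)
  rw [berwaldDerivCurvature, hS.berwaldDeriv_berwaldDeriv_eq hξ hη hZ hq,
    hS.berwaldDeriv_berwaldDeriv_eq hη hξ hZ hq, hS.berwaldDeriv_eq hb hZ hq,
    fderiv_fderiv_comm hS.isOpen hZ hq (η q)]
  simp only [VectorField.lieBracket, map_sub, Prod.fst_sub, _root_.sub_apply]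
  abel

theorem berwaldCurvature_eq {X Y Z : V × V → V} (hX : ContDiffOn ℝ ∞ X O)
    (hY : ContDiffOn ℝ ∞ Y O) (hZ : ContDiffOn ℝ ∞ Z O) {q : V × V} (hq : q ∈ O) :
    berwaldCurvature S X Y Z q = berwaldTensor S q (X q) (Y q) (Z q) := by
  rw [berwaldCurvature,
    hS.berwaldDerivCurvature_eq (ξ := vert X) (contDiffOn_const.prodMk hX) (hS.smooth_horLift hY) hZ hq]
  simp [vert, horLift, hS.hor_eq hq, berwaldTensor, fiberDeriv_apply]

theorem affineCurvature_eq {X Y Z : V × V → V} (hX : ContDiffOn ℝ ∞ X O)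
    (hY : ContDiffOn ℝ ∞ Y O) (hZ : ContDiffOn ℝ ∞ Z O) {q : V × V} (hq : q ∈ O) :
    affineCurvature S X Y Z q =
      fderiv ℝ (berwaldCoeff S) q (X q, -connCoeff S q (X q)) (Y q) (Z q) -
      fderiv ℝ (berwaldCoeff S) q (Y q, -connCoeff S q (Y q)) (X q) (Z q) +
      berwaldCoeff S q (X q) (berwaldCoeff S q (Y q) (Z q)) -
      berwaldCoeff S q (Y q) (berwaldCoeff S q (X q) (Z q)) := by
  rw [affineCurvature,
    hS.berwaldDerivCurvature_eq (hS.smooth_horLift hX) (hS.smooth_horLift hY) hZ hq]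
  simp only [horLift, hS.hor_eq hq]

end IsSemispray
end Local

/-! ### The Bianchi-type identity relating `∇ᵛ𝐇` to `∇ʰ𝐁`, and the metric in coordinates. -/

section Local

variable {V : Type*} [NormedAddCommGroup V] [NormedSpace ℝ V]
  {O : Set (V × V)}

/-- The h-Berwald differential of the Berwald curvature in coordinates, in the direction `w`. -/
def berwaldTensorDeriv (S : V × V → V × V) (q : V × V) (w x y z : V) : V :=
  fderiv ℝ (berwaldTensor S) q (w, -connCoeff S q w) x y z +
    berwaldCoeff S q w (berwaldTensor S q x y z) - berwaldTensor S q (berwaldCoeff S q w x) y z -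
    berwaldTensor S q x (berwaldCoeff S q w y) z - berwaldTensor S q x y (berwaldCoeff S q w z)

namespace IsSemispray

variable {S : V × V → V × V} (hS : IsSemispray O S)

include hS

theorem berwaldTensorDeriv_symm_left {q : V × V} (hq : q ∈ O) (w x y z : V) :
    berwaldTensorDeriv S q w x y z = berwaldTensorDeriv S q w y x z := by
  simp only [berwaldTensorDeriv]
  rw [hS.fderiv_berwaldTensor_symm_left hq, hS.berwaldTensor_symm_left hq x y z,
    hS.berwaldTensor_symm_left hq _ y z, hS.berwaldTensor_symm_left hq x _ z,
    hS.berwaldTensor_symm_left hq x y _]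
  abel

theorem fderiv_horizontal {Y : V × V → V} (hY : ContDiffOn ℝ ∞ Y O) {q : V × V} (hq : q ∈ O)
    (x : V) : fderiv ℝ (fun p => (Y p, -connCoeff S p (Y p))) q (0, x) =
      (fderiv ℝ Y q (0, x), -connCoeff S q (fderiv ℝ Y q (0, x))) +
        (0, -berwaldCoeff S q x (Y q)) := by
  have dY := hY.diffAt hS.isOpen hq
  have dN := hS.smooth_connCoeff.diffAt hS.isOpen hq
  have h := dY.fderiv_prodMk (dN.clm_apply dY).neg
  have h3 : fderiv ℝ (fun p => -connCoeff S p (Y p)) q (0, x) =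
      -(fderiv ℝ (connCoeff S) q (0, x) (Y q) + connCoeff S q (fderiv ℝ Y q (0, x))) := by
    rw [fderiv_fun_neg, _root_.neg_apply, fderiv_clm_apply_apply dN dY]
  have h' : fderiv ℝ (fun p => (Y p, -connCoeff S p (Y p))) q (0, x) =
      (fderiv ℝ Y q (0, x), fderiv ℝ (fun p => -connCoeff S p (Y p)) q (0, x)) :=
    DFunLike.congr_fun h (0, x)
  rw [h', h3, berwaldCoeff, fiberDeriv_apply]
  ext
  · simp
  · simp

/-- The affine curvature is this expression antisymmetrised in `Y` and `Z`. -/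
theorem fderiv_affineCurvature_term {Y Z U : V × V → V} (hY : ContDiffOn ℝ ∞ Y O)
    (hZ : ContDiffOn ℝ ∞ Z O) (hU : ContDiffOn ℝ ∞ U O) {q : V × V} (hq : q ∈ O) (x : V) :
    fderiv ℝ (fun p => fderiv ℝ (berwaldCoeff S) p (Y p, -connCoeff S p (Y p)) (Z p) (U p) +
      berwaldCoeff S p (Y p) (berwaldCoeff S p (Z p) (U p))) q (0, x) =
    fderiv ℝ (berwaldTensor S) q (Y q, -connCoeff S q (Y q)) x (Z q) (U q) +
    fderiv ℝ (berwaldCoeff S) q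
      (fderiv ℝ Y q (0, x), -connCoeff S q (fderiv ℝ Y q (0, x))) (Z q) (U q) -
    berwaldTensor S q (berwaldCoeff S q x (Y q)) (Z q) (U q) +
    fderiv ℝ (berwaldCoeff S) q (Y q, -connCoeff S q (Y q)) (fderiv ℝ Z q (0, x)) (U q) +
    fderiv ℝ (berwaldCoeff S) q (Y q, -connCoeff S q (Y q)) (Z q) (fderiv ℝ U q (0, x)) +
    (berwaldTensor S q x (Y q) (berwaldCoeff S q (Z q) (U q)) +
    berwaldCoeff S q (fderiv ℝ Y q (0, x)) (berwaldCoeff S q (Z q) (U q)) +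
    berwaldCoeff S q (Y q) (berwaldTensor S q x (Z q) (U q)) +
    berwaldCoeff S q (Y q) (berwaldCoeff S q (fderiv ℝ Z q (0, x)) (U q)) +
    berwaldCoeff S q (Y q) (berwaldCoeff S q (Z q) (fderiv ℝ U q (0, x)))) := by
  have dY := hY.diffAt hS.isOpen hq
  have dZ := hZ.diffAt hS.isOpen hq
  have dU := hU.diffAt hS.isOpen hq
  have dG := hS.smooth_berwaldCoeff.diffAt hS.isOpen hq
  have dG' := (smoothOn_fderiv hS.isOpen hS.smooth_berwaldCoeff).diffAt hS.isOpen hq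
  have dh : DifferentiableAt ℝ (fun p => (Y p, -connCoeff S p (Y p))) q :=
    dY.prodMk ((hS.smooth_connCoeff.diffAt hS.isOpen hq).clm_apply dY).neg
  have dGZU := (dG.clm_apply dZ).clm_apply dU
  have hB : ∀ x y z, fderiv ℝ (berwaldCoeff S) q (0, x) y z = berwaldTensor S q x y z :=
    fun _ _ _ => rfl
  have hB' : fderiv ℝ (berwaldCoeff S) q (0, -berwaldCoeff S q x (Y q)) =
      -fderiv ℝ (berwaldCoeff S) q (0, berwaldCoeff S q x (Y q)) := by
    rw [show ((0 : V), -berwaldCoeff S q x (Y q)) = -(0, berwaldCoeff S q x (Y q)) by simp,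
      map_neg]
  -- Exchanging the vertical and the horizontal derivative of `G_yy` makes the horizontal derivative
  -- of `G_yyy` appear.
  have h2 : fderiv ℝ (fderiv ℝ (berwaldCoeff S)) q (0, x) (Y q, -connCoeff S q (Y q)) =
      fderiv ℝ (berwaldTensor S) q (Y q, -connCoeff S q (Y q)) x := by
    rw [fderiv_fderiv_comm hS.isOpen hS.smooth_berwaldCoeff hq, berwaldTensor,
      fderiv_fiberDeriv hS.isOpen hS.smooth_berwaldCoeff hq]
  rw [fderiv_fun_add (((dG'.clm_apply dh).clm_apply dZ).clm_apply dU)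
      ((dG.clm_apply dY).clm_apply dGZU), _root_.add_apply,
    fderiv_clm_apply_apply ((dG'.clm_apply dh).clm_apply dZ) dU,
    fderiv_clm_apply_apply (dG'.clm_apply dh) dZ, fderiv_clm_apply_apply dG' dh,
    fderiv_clm_apply_apply (dG.clm_apply dY) dGZU, fderiv_clm_apply_apply dG dY,
    fderiv_clm_apply_apply (dG.clm_apply dZ) dU, fderiv_clm_apply_apply dG dZ,
    hS.fderiv_horizontal hY hq, h2]
  simp only [map_add, _root_.add_apply, hB', _root_.neg_apply, hB]
  abel

/-- The Leibniz corrections cancel all derivatives of `Y`, `Z`, `U`. Of the connection terms in the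
two `berwaldTensorDeriv`, those containing `G_yy(Y, Z)` cancel by symmetry; the others match term by
term. -/
theorem vDerivAffineCurvature_eq {X Y Z U : V × V → V} (hX : ContDiffOn ℝ ∞ X O)
    (hY : ContDiffOn ℝ ∞ Y O) (hZ : ContDiffOn ℝ ∞ Z O) (hU : ContDiffOn ℝ ∞ U O)
    {q : V × V} (hq : q ∈ O) :
    vDerivAffineCurvature S X Y Z U q =
      berwaldTensorDeriv S q (Y q) (X q) (Z q) (U q) -
        berwaldTensorDeriv S q (Z q) (X q) (Y q) (U q) := by
  have dX := hX.diffAt hS.isOpen hq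
  have smooth_term : ∀ {Y Z : V × V → V}, ContDiffOn ℝ ∞ Y O → ContDiffOn ℝ ∞ Z O →
      ContDiffOn ℝ ∞ (fun p =>
        fderiv ℝ (berwaldCoeff S) p (Y p, -connCoeff S p (Y p)) (Z p) (U p) +
          berwaldCoeff S p (Y p) (berwaldCoeff S p (Z p) (U p))) O := fun {Y Z} hY hZ =>
    ((((smoothOn_fderiv hS.isOpen hS.smooth_berwaldCoeff).clm_apply
      (hY.prodMk (hS.smooth_connCoeff.clm_apply hY).neg)).clm_apply hZ).clm_apply hU).add
      ((hS.smooth_berwaldCoeff.clm_apply hY).clm_apply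
        ((hS.smooth_berwaldCoeff.clm_apply hZ).clm_apply hU))
  have hA : ∀ p ∈ O, affineCurvature S Y Z U p =
      (fderiv ℝ (berwaldCoeff S) p (Y p, -connCoeff S p (Y p)) (Z p) (U p) +
          berwaldCoeff S p (Y p) (berwaldCoeff S p (Z p) (U p))) -
      (fderiv ℝ (berwaldCoeff S) p (Z p, -connCoeff S p (Z p)) (Y p) (U p) +
          berwaldCoeff S p (Z p) (berwaldCoeff S p (Y p) (U p))) := fun p hp => by
    rw [hS.affineCurvature_eq hY hZ hU hp]
    abel
  have sA : ContDiffOn ℝ ∞ (affineCurvature S Y Z U) O :=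
    ((smooth_term hY hZ).sub (smooth_term hZ hY)).congr hA
  rw [vDerivAffineCurvature, vDeriv_eq dX (sA.diffAt hS.isOpen hq),
    hS.affineCurvature_eq (smooth_vDeriv hS.isOpen hX hY) hZ hU hq,
    hS.affineCurvature_eq hY (smooth_vDeriv hS.isOpen hX hZ) hU hq,
    hS.affineCurvature_eq hY hZ (smooth_vDeriv hS.isOpen hX hU) hq,
    vDeriv_eq dX (hY.diffAt hS.isOpen hq), vDeriv_eq dX (hZ.diffAt hS.isOpen hq),
    vDeriv_eq dX (hU.diffAt hS.isOpen hq), fderiv_congr_on hS.isOpen hA hq,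
    fderiv_fun_sub ((smooth_term hY hZ).diffAt hS.isOpen hq)
      ((smooth_term hZ hY).diffAt hS.isOpen hq), _root_.sub_apply,
    hS.fderiv_affineCurvature_term hY hZ hU hq, hS.fderiv_affineCurvature_term hZ hY hU hq,
    berwaldTensorDeriv, berwaldTensorDeriv, hS.berwaldCoeff_symm hq (X q) (Y q),
    hS.berwaldCoeff_symm hq (X q) (Z q), hS.berwaldCoeff_symm hq (Z q) (Y q)]
  abel

end IsSemispray

/-! ### The metric tensor in coordinates -/

theorem vDiff₂_eq (hO : IsOpen O) {f : V × V → ℝ} (hf : ContDiffOn ℝ ∞ f O) {X Y : V × V → V}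
    {q : V × V} (hq : q ∈ O) (dX : DifferentiableAt ℝ X q) (dY : DifferentiableAt ℝ Y q) :
    vDiff₂ f X Y q = fiberDeriv (fiberDeriv f) q (X q) (Y q) := by
  have h : along (vert X) (vDiff f Y) q =
      fderiv ℝ (fun p => fiberDeriv f p (Y p)) q (0, X q) := rfl
  have h' : vDiff f (vDeriv X Y) q = fiberDeriv f q (vDeriv X Y q) := rfl
  rw [vDiff₂, h, h', vDeriv_eq dX dY,
    fderiv_clm_apply_apply ((smoothOn_fiberDeriv hO hf).diffAt hO hq) dY]
  simp [fiberDeriv_apply]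

theorem smoothOn_energy {L : V × V → ℝ} (hL : ContDiffOn ℝ ∞ L O) :
    ContDiffOn ℝ ∞ (energy L) O :=
  contDiffOn_const.mul (hL.pow 2)

theorem metric_eq (hO : IsOpen O) {L : V × V → ℝ} (hL : ContDiffOn ℝ ∞ L O) {X Y : V × V → V}
    {q : V × V} (hq : q ∈ O) (dX : DifferentiableAt ℝ X q) (dY : DifferentiableAt ℝ Y q) :
    metric L X Y q = fiberDeriv (fiberDeriv (energy L)) q (X q) (Y q) := by
  have sL : ContDiffOn ℝ ∞ (fun p => L p ^ 2) O := hL.pow 2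
  have h1 : ∀ p ∈ O, fiberDeriv (energy L) p = (1 / 2 : ℝ) • fiberDeriv (fun p => L p ^ 2) p :=
    fun p hp => by
      ext w
      exact DFunLike.congr_fun (fderiv_fun_const_smul (sL.diffAt hO hp) (1 / 2 : ℝ)) (0, w)
  rw [metric, vDiff₂_eq hO sL hq dX dY, fiberDeriv_apply (fiberDeriv (energy L)),
    fderiv_congr_on hO h1 hq, fderiv_fun_const_smul ((smoothOn_fiberDeriv hO sL).diffAt hO hq)]
  rfl

end Local

section Local

variable {V : Type*} [NormedAddCommGroup V] [NormedSpace ℝ V]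

/-! ### Finsler functions on a chart domain -/

/-- Finsler functions on an open subset of a normed space, in coordinates. -/
structure IsLocalFinsler (U : Set V) (L : V × V → ℝ) : Prop where
  isOpen : IsOpen U
  smooth : ContDiffOn ℝ ∞ L (slit U)
  homogeneous : ∀ q ∈ slit U, ∀ c : ℝ, 0 < c → L (q.1, c • q.2) = c * L q
  nondegenerate : ∀ q ∈ slit U, ∀ w : V,
    (∀ u : V, metric L (fun _ => w) (fun _ => u) q = 0) → w = 0

/-- The form `E_y`, that is, `g(δ, ·)`. -/
def fiberEnergy (L : V × V → ℝ) : V × V → V →L[ℝ] ℝ := fiberDeriv (energy L)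

namespace IsLocalFinsler

variable {U : Set V} {L : V × V → ℝ} (hL : IsLocalFinsler U L)

include hL

theorem isOpen_slit : IsOpen (slit U) := Finsler.isOpen_slit hL.isOpen

theorem smooth_energy : ContDiffOn ℝ ∞ (energy L) (slit U) := smoothOn_energy hL.smooth

theorem smooth_fiberEnergy : ContDiffOn ℝ ∞ (fiberEnergy L) (slit U) :=
  smoothOn_fiberDeriv hL.isOpen_slit hL.smooth_energy

theorem smooth_fiberMetric : ContDiffOn ℝ ∞ (fiberDeriv (fiberEnergy L)) (slit U) :=
  smoothOn_fiberDeriv hL.isOpen_slit hL.smooth_fiberEnergy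

theorem fiberMetric_symm {q : V × V} (hq : q ∈ slit U) (v w : V) :
    fderiv ℝ (fiberEnergy L) q (0, v) w = fderiv ℝ (fiberEnergy L) q (0, w) v :=
  fiberDeriv_fiberDeriv_comm hL.isOpen_slit hL.smooth_energy hq v w

theorem eq_zero_of_fiberMetric {q : V × V} (hq : q ∈ slit U) {w : V}
    (h : ∀ u, fderiv ℝ (fiberEnergy L) q (0, w) u = 0) : w = 0 := by
  refine hL.nondegenerate q hq w fun u => ?_
  rw [metric_eq hL.isOpen_slit hL.smooth hq (differentiableAt_const w) (differentiableAt_const u)]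
  exact h u

theorem fderiv_fiberEnergy {q : V × V} (hq : q ∈ slit U) (a : V × V) (w : V) :
    fderiv ℝ (fiberEnergy L) q a w = fderiv ℝ (fderiv ℝ (energy L)) q a (0, w) :=
  fderiv_fiberDeriv hL.isOpen_slit hL.smooth_energy hq a w

/-- Euler's relation for the 2-homogeneous energy: `E(x, cy) = c² E(x, y)` is differentiated at `c =
1`. -/
theorem fiberEnergy_canonical {q : V × V} (hq : q ∈ slit U) :
    fiberEnergy L q q.2 = 2 * energy L q := by
  have hc : HasDerivAt (fun c : ℝ => (q.1, c • q.2)) (0, q.2) 1 := by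
    simpa using (hasDerivAt_const (1 : ℝ) q.1).prodMk ((hasDerivAt_id (1 : ℝ)).smul_const q.2)
  have hd := (hL.smooth_energy.diffAt hL.isOpen_slit hq).hasFDerivAt
  have hd' : HasFDerivAt (energy L) (fderiv ℝ (energy L) q) (q.1, (1 : ℝ) • q.2) := by
    simpa using hd
  have h1 := hd'.comp_hasDerivAt (1 : ℝ) hc
  have h2 : HasDerivAt (fun c : ℝ => c ^ 2 * energy L q) (2 * energy L q) 1 := by
    simpa using (hasDerivAt_pow 2 (1 : ℝ)).mul_const (energy L q)
  have h3 : (energy L ∘ fun c : ℝ => (q.1, c • q.2)) =ᶠ[nhds 1]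
      fun c : ℝ => c ^ 2 * energy L q := by
    filter_upwards [lt_mem_nhds (zero_lt_one' ℝ)] with c hc
    simp only [Function.comp_apply, energy, hL.homogeneous q hq c hc]
    ring
  exact (h1.congr_of_eventuallyEq h3.symm).unique h2

theorem fderiv_fiberEnergy_canonical {q : V × V} (hq : q ∈ slit U) (a : V × V) :
    fderiv ℝ (fiberEnergy L) q a q.2 + fiberEnergy L q a.2 = 2 * fderiv ℝ (energy L) q a := by
  have dθ := hL.smooth_fiberEnergy.diffAt hL.isOpen_slit hq
  have dE := hL.smooth_energy.diffAt hL.isOpen_slit hq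
  have h : fderiv ℝ (fun p : V × V => fiberEnergy L p p.2) q a =
      fderiv ℝ (fun p => 2 * energy L p) q a := by
    rw [fderiv_congr_on hL.isOpen_slit (fun p hp => hL.fiberEnergy_canonical hp) hq]
  rw [fderiv_clm_apply_apply dθ differentiableAt_snd, fderiv_snd,
    fderiv_const_mul dE] at h
  simpa using h

theorem fiberMetric_canonical {q : V × V} (hq : q ∈ slit U) (w : V) :
    fderiv ℝ (fiberEnergy L) q (0, q.2) w = fiberEnergy L q w := by
  have h := hL.fderiv_fiberEnergy_canonical hq (0, w)
  have h' : fderiv ℝ (energy L) q (0, w) = fiberEnergy L q w := rfl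
  rw [hL.fiberMetric_symm hq, h'] at h
  rw [hL.fiberMetric_symm hq, hL.fiberMetric_symm hq]
  linarith

theorem ddJE_apply {q : V × V} (hq : q ∈ slit U) (a b : V × V) :
    ddJE L q a b = fderiv ℝ (fiberEnergy L) q a b.1 - fderiv ℝ (fiberEnergy L) q b a.1 := by
  have dθ := (smoothOn_fderiv hL.isOpen_slit hL.smooth_energy).diffAt hL.isOpen_slit hq
  have h : ∀ a b, fderiv ℝ (dJE L) q a b = fderiv ℝ (fiberEnergy L) q a b.1 := fun a b => by
    have h1 := (dθ.hasFDerivAt.clm_comp (hasFDerivAt_const (vertEndo (V := V)) q)).fderiv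
    have h2 : fderiv ℝ (dJE L) q = _ := h1
    rw [h2, hL.fderiv_fiberEnergy hq]
    simp [vertEndo]
  simp only [ddJE, _root_.sub_apply, ContinuousLinearMap.flip_apply, h]

theorem smooth_ddJE : ContDiffOn ℝ ∞ (ddJE L) (slit U) := by
  have h : ContDiffOn ℝ ∞ (dJE L) (slit U) :=
    (smoothOn_fderiv hL.isOpen_slit hL.smooth_energy).clm_comp contDiffOn_const
  have h' := smoothOn_fderiv hL.isOpen_slit h
  exact h'.sub ((ContinuousLinearMap.flipₗᵢ ℝ (V × V) (V × V) ℝ).contDiff.comp_contDiffOn h')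

/-- Vertical test vectors detect the base component of `a`; once it is zero, the vectors `(u, 0)`
detect the fibre component. Both times non-degeneracy of `g` concludes. -/
theorem ddJE_injective {q : V × V} (hq : q ∈ slit U) : Function.Injective (ddJE L q) := by
  rw [injective_iff_map_eq_zero]
  intro a ha
  have h : ∀ b : V × V,
      fderiv ℝ (fiberEnergy L) q a b.1 - fderiv ℝ (fiberEnergy L) q b a.1 = 0 := fun b => by
    rw [← hL.ddJE_apply hq, ha]; rfl
  have h1 : a.1 = 0 := hL.eq_zero_of_fiberMetric hq fun u => by
    have := h (0, u)
    rw [hL.fiberMetric_symm hq]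
    simpa using this
  have h2 : a.2 = 0 := hL.eq_zero_of_fiberMetric hq fun u => by
    have := h (u, 0)
    rw [h1, map_zero, sub_zero] at this
    rw [← h1]
    exact this
  exact Prod.ext h1 h2

/-! ### The canonical spray, its homogeneity, and horizontal parallelism. -/

variable [FiniteDimensional ℝ V]

theorem ddJE_eq_equiv {q : V × V} (hq : q ∈ slit U) :
    ∃ e : (V × V) ≃L[ℝ] (V × V →L[ℝ] ℝ), (e : (V × V) →L[ℝ] (V × V →L[ℝ] ℝ)) = ddJE L q := by
  have hrank : Module.finrank ℝ (V × V) = Module.finrank ℝ (V × V →L[ℝ] ℝ) := by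
    rw [← (LinearMap.toContinuousLinearMap (𝕜 := ℝ) (E := V × V) (F' := ℝ)).finrank_eq]
    exact (Subspace.dual_finrank_eq (K := ℝ) (V := V × V)).symm
  refine ⟨(LinearEquiv.ofInjectiveOfFinrankEq (ddJE L q : (V × V) →ₗ[ℝ] _)
    (hL.ddJE_injective hq) hrank).toContinuousLinearEquiv, ?_⟩
  exact ContinuousLinearMap.ext fun _ => rfl

theorem canonicalSpray_spec {q : V × V} (hq : q ∈ slit U) :
    ddJE L q (canonicalSpray L q) = -fderiv ℝ (energy L) q := by
  obtain ⟨e, he⟩ := hL.ddJE_eq_equiv hq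
  rw [canonicalSpray, if_neg hq.2, ← he, ContinuousLinearMap.inverse_equiv]
  simp

theorem smooth_canonicalSpray : ContDiffOn ℝ ∞ (canonicalSpray L) (slit U) := by
  intro q hq
  obtain ⟨e, he⟩ := hL.ddJE_eq_equiv hq
  have h1 : ContDiffAt ℝ ∞ ContinuousLinearMap.inverse (ddJE L q) := by
    rw [← he]; exact contDiffAt_map_inverse e
  have h2 := h1.comp_contDiffWithinAt q (hL.smooth_ddJE q hq)
  have h3 := h2.clm_apply
    ((smoothOn_fderiv hL.isOpen_slit hL.smooth_energy).neg q hq)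
  exact h3.congr (fun p hp => by simp [canonicalSpray, hp.2]) (by simp [canonicalSpray, hq.2])

/-- On vertical vectors the spray equation reads `g(𝐣S, u) = E_y(u)`, and `E_y(u) = g(δ, u)` by
homogeneity. -/
theorem canonicalSpray_fst {q : V × V} (hq : q ∈ slit U) : (canonicalSpray L q).1 = q.2 := by
  rw [← sub_eq_zero]
  refine hL.eq_zero_of_fiberMetric hq fun u => ?_
  have h := DFunLike.congr_fun (hL.canonicalSpray_spec hq) (0, u)
  rw [hL.ddJE_apply hq, _root_.neg_apply, hL.fiberMetric_symm hq u] at h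
  have h' : fderiv ℝ (energy L) q (0, u) = fiberEnergy L q u := rfl
  rw [h', ← hL.fiberMetric_canonical hq] at h
  rw [show ((0 : V), (canonicalSpray L q).1 - q.2) = (0, (canonicalSpray L q).1) - (0, q.2) by simp,
    map_sub, _root_.sub_apply]
  simp only [map_zero] at h
  linarith

theorem isSemispray : IsSemispray (slit U) (canonicalSpray L) :=
  ⟨hL.isOpen_slit, hL.smooth_canonicalSpray, fun _ hq => hL.canonicalSpray_fst hq⟩

/-- The Euler–Lagrange equation `S(E_y) = E_x`: the spray equation on `(b, 0)`, simplified by the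
differentiated Euler relation. -/
theorem fderiv_fiberEnergy_spray {q : V × V} (hq : q ∈ slit U) (b : V) :
    fderiv ℝ (fiberEnergy L) q (canonicalSpray L q) b = fderiv ℝ (energy L) q (b, 0) := by
  have h := DFunLike.congr_fun (hL.canonicalSpray_spec hq) (b, 0)
  have h' := hL.fderiv_fiberEnergy_canonical hq (b, 0)
  rw [hL.ddJE_apply hq, hL.canonicalSpray_fst hq, _root_.neg_apply] at h
  simp only [map_zero] at h'
  linarith

theorem fderiv_energy_spray {q : V × V} (hq : q ∈ slit U) :
    fderiv ℝ (energy L) q (canonicalSpray L q) = 0 := by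
  have hs : canonicalSpray L q = (q.2, 0) + (0, (canonicalSpray L q).2) := by
    ext
    · simp [hL.canonicalSpray_fst hq]
    · simp
  have h1 := hL.fderiv_fiberEnergy_spray hq q.2
  have h2 := hL.fderiv_fiberEnergy_canonical hq (q.2, 0)
  have h3 : fderiv ℝ (energy L) q (0, (canonicalSpray L q).2) =
    fiberEnergy L q (canonicalSpray L q).2 := rfl
  rw [hs, map_add, _root_.add_apply, hL.fiberMetric_symm hq, hL.fiberMetric_canonical hq] at h1
  rw [hs, map_add, h3]
  simp only [map_zero] at h2
  linarith

theorem fderiv_spray {q : V × V} (hq : q ∈ slit U) (w : V) :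
    fderiv ℝ (canonicalSpray L) q (0, w) = (w, (-2 : ℝ) • connCoeff (canonicalSpray L) q w) := by
  have hd := hL.smooth_canonicalSpray.diffAt hL.isOpen_slit hq
  have e1 := DFunLike.congr_fun (fderiv.fst hd) (0, w)
  have e2 := DFunLike.congr_fun (fderiv.snd hd) (0, w)
  rw [fderiv_congr_on hL.isOpen_slit (fun p hp => hL.canonicalSpray_fst hp) hq, fderiv_snd] at e1
  ext
  · simpa using e1.symm
  · simp only [connCoeff, fiberDeriv_apply, _root_.smul_apply, smul_smul]
    rw [e2]
    norm_num

/-- The energy is constant along horizontal vector fields. -/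
theorem fderiv_energy_hor {q : V × V} (hq : q ∈ slit U) (w : V) :
    fderiv ℝ (energy L) q (w, -connCoeff (canonicalSpray L) q w) = 0 := by
  have dE := (smoothOn_fderiv hL.isOpen_slit hL.smooth_energy).diffAt hL.isOpen_slit hq
  have dS := hL.smooth_canonicalSpray.diffAt hL.isOpen_slit hq
  -- The conservation law `S E = 0` is differentiated along the fibre. By Euler–Lagrange, the two
  -- resulting terms add up to twice the derivative of `E` along the horizontal lift of `w`.
  have h : fderiv ℝ (fun p => fderiv ℝ (energy L) p (canonicalSpray L p)) q (0, w) = 0 := by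
    rw [fderiv_congr_on hL.isOpen_slit (fun p hp => hL.fderiv_energy_spray hp) hq]
    simp
  rw [fderiv_clm_apply_apply dE dS, fderiv_fderiv_comm hL.isOpen_slit hL.smooth_energy hq,
    ← hL.fderiv_fiberEnergy hq, hL.fderiv_fiberEnergy_spray hq, hL.fderiv_spray hq,
    ← map_add] at h
  have h2 : (w, (0 : V)) + (w, (-2 : ℝ) • connCoeff (canonicalSpray L) q w) =
      (2 : ℝ) • (w, -connCoeff (canonicalSpray L) q w) := by
    ext
    · simp [two_smul]
    · simp
  rw [h2, map_smul] at h
  simpa using h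

/-- The canonical form `g(δ, ·)` is parallel along horizontal vector fields. -/
theorem fderiv_fiberEnergy_hor {q : V × V} (hq : q ∈ slit U) (w v : V) :
    fderiv ℝ (fiberEnergy L) q (w, -connCoeff (canonicalSpray L) q w) v =
      fiberEnergy L q (berwaldCoeff (canonicalSpray L) q w v) := by
  have hS := hL.isSemispray
  have dE := (smoothOn_fderiv hL.isOpen_slit hL.smooth_energy).diffAt hL.isOpen_slit hq
  have dN : DifferentiableAt ℝ (fun p => (w, -connCoeff (canonicalSpray L) p w)) q :=
    (differentiableAt_const w).prodMk
      ((hS.smooth_connCoeff.diffAt hL.isOpen_slit hq).clm_apply (differentiableAt_const w)).neg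
  -- Fibre derivative of the identity `(𝓗w) E = 0`.
  have h : fderiv ℝ (fun p => fderiv ℝ (energy L) p (w, -connCoeff (canonicalSpray L) p w)) q
      (0, v) = 0 := by
    rw [fderiv_congr_on hL.isOpen_slit (fun p hp => hL.fderiv_energy_hor hp w) hq]
    simp
  rw [fderiv_clm_apply_apply dE dN, fderiv_fderiv_comm hL.isOpen_slit hL.smooth_energy hq,
    ← hL.fderiv_fiberEnergy hq, hS.fderiv_horizontal contDiffOn_const hq] at h
  have h2 : ∀ z, fderiv ℝ (energy L) q (0, z) = fiberEnergy L q z := fun _ => rfl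
  simp only [fderiv_fun_const, Pi.zero_apply, _root_.zero_apply, map_zero, neg_zero,
    Prod.mk_add_mk, zero_add, h2, map_neg] at h
  rw [hS.berwaldCoeff_symm hq]
  linarith

/-- The h-Berwald differential of the metric tensor in coordinates. -/
theorem fderiv_fiberMetric_hor {q : V × V} (hq : q ∈ slit U) (w v z : V) :
    fderiv ℝ (fiberDeriv (fiberEnergy L)) q (w, -connCoeff (canonicalSpray L) q w) z v =
      fiberDeriv (fiberEnergy L) q (berwaldCoeff (canonicalSpray L) q w z) v +
      fiberDeriv (fiberEnergy L) q z (berwaldCoeff (canonicalSpray L) q w v) +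
      fiberEnergy L q (berwaldTensor (canonicalSpray L) q z w v) := by
  have hS := hL.isSemispray
  have dθ := hL.smooth_fiberEnergy.diffAt hL.isOpen_slit hq
  have dθ' := (smoothOn_fderiv hL.isOpen_slit hL.smooth_fiberEnergy).diffAt hL.isOpen_slit hq
  have dN : DifferentiableAt ℝ (fun p => (w, -connCoeff (canonicalSpray L) p w)) q :=
    (differentiableAt_const w).prodMk
      ((hS.smooth_connCoeff.diffAt hL.isOpen_slit hq).clm_apply (differentiableAt_const w)).neg
  have dG := hS.smooth_berwaldCoeff.diffAt hL.isOpen_slit hq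
  -- A further fibre derivative, now of the parallelism of `E_y`; differentiating `G_yy` produces
  -- the `G_yyy` term, which is all that remains in `∇ʰg`.
  have h : fderiv ℝ
      (fun p => fderiv ℝ (fiberEnergy L) p (w, -connCoeff (canonicalSpray L) p w) v) q (0, z) =
      fderiv ℝ (fun p => fiberEnergy L p (berwaldCoeff (canonicalSpray L) p w v)) q (0, z) := by
    rw [fderiv_congr_on hL.isOpen_slit (fun p hp => hL.fderiv_fiberEnergy_hor hp w v) hq]
  rw [fderiv_const_apply (dθ'.clm_apply dN), fderiv_clm_apply_apply dθ' dN,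
    fderiv_fderiv_comm hL.isOpen_slit hL.smooth_fiberEnergy hq,
    fderiv_clm_apply_apply dθ ((dG.clm_apply (differentiableAt_const w)).clm_apply
      (differentiableAt_const v)),
    fderiv_const_apply (dG.clm_apply (differentiableAt_const w)), fderiv_const_apply dG,
    hS.fderiv_horizontal contDiffOn_const hq, _root_.add_apply,
    ← fderiv_fiberDeriv hL.isOpen_slit hL.smooth_fiberEnergy hq] at h
  have h2 : ∀ x, fderiv ℝ (fiberEnergy L) q (0, x) = fiberDeriv (fiberEnergy L) q x := fun _ => rfl
  have h3 : fderiv ℝ (berwaldCoeff (canonicalSpray L)) q (0, z) =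
    berwaldTensor (canonicalSpray L) q z := rfl
  simp only [fderiv_fun_const, Pi.zero_apply, _root_.zero_apply, map_zero, neg_zero,
    Prod.mk_add_mk, zero_add, h2, h3, map_neg, _root_.neg_apply] at h
  rw [hS.berwaldCoeff_symm hq w z]
  linarith

/-- The canonical spray is homogeneous of degree `2`. -/
theorem connCoeff_canonical {q : V × V} (hq : q ∈ slit U) :
    connCoeff (canonicalSpray L) q q.2 = -(canonicalSpray L q).2 := by
  have dθ := hL.smooth_fiberEnergy.diffAt hL.isOpen_slit hq
  have dθ' := (smoothOn_fderiv hL.isOpen_slit hL.smooth_fiberEnergy).diffAt hL.isOpen_slit hq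
  have dE := (smoothOn_fderiv hL.isOpen_slit hL.smooth_energy).diffAt hL.isOpen_slit hq
  have dS := hL.smooth_canonicalSpray.diffAt hL.isOpen_slit hq
  have hs : canonicalSpray L q = (q.2, 0) + (0, (canonicalSpray L q).2) := by
    ext
    · simp [hL.canonicalSpray_fst hq]
    · simp
  rw [← sub_eq_zero, sub_neg_eq_add]
  refine hL.eq_zero_of_fiberMetric hq fun b => ?_
  -- Two identities are differentiated: `g(δ, b) = E_y(b)` along `S`, and Euler–Lagrange along `(0,
  -- y)`. Both contain the same second derivative of `E_y`, in the directions `S` and `(0, y)`,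
  -- which is eliminated between them.
  have hg : ∀ a, fderiv ℝ (fun p : V × V => fiberDeriv (fiberEnergy L) p p.2 b) q a =
      fderiv ℝ (fun p => fiberEnergy L p b) q a := fun a => by
    rw [fderiv_congr_on hL.isOpen_slit
      (f := fun p : V × V => fiberDeriv (fiberEnergy L) p p.2 b) (f' := fun p => fiberEnergy L p b)
      (fun p hp => hL.fiberMetric_canonical hp b) hq]
  have dg := hL.smooth_fiberMetric.diffAt hL.isOpen_slit hq
  have hg1 := hg (canonicalSpray L q)
  rw [fderiv_const_apply (dg.clm_apply differentiableAt_snd),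
    fderiv_clm_apply_apply dg differentiableAt_snd, fderiv_const_apply dθ, fderiv_snd,
    fderiv_fiberDeriv hL.isOpen_slit hL.smooth_fiberEnergy hq] at hg1
  have h : fderiv ℝ (fun p => fderiv ℝ (fiberEnergy L) p (canonicalSpray L p) b) q (0, q.2) =
      fderiv ℝ (fun p => fderiv ℝ (energy L) p (b, 0)) q (0, q.2) := by
    rw [fderiv_congr_on hL.isOpen_slit (fun p hp => hL.fderiv_fiberEnergy_spray hp b) hq]
  rw [fderiv_const_apply (dθ'.clm_apply dS), fderiv_clm_apply_apply dθ' dS, fderiv_const_apply dE,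
    fderiv_fderiv_comm hL.isOpen_slit hL.smooth_energy hq (0, q.2),
    ← hL.fderiv_fiberEnergy hq, fderiv_fderiv_comm hL.isOpen_slit hL.smooth_fiberEnergy hq,
    hL.fderiv_spray hq] at h
  have h1 := hL.fderiv_fiberEnergy_canonical hq (b, 0)
  have h2 := hL.fderiv_fiberEnergy_spray hq b
  rw [hs, map_add, _root_.add_apply] at h2
  have h4 : fderiv ℝ (fiberEnergy L) q (q.2, (-2 : ℝ) • connCoeff (canonicalSpray L) q q.2) b =
      fderiv ℝ (fiberEnergy L) q (q.2, 0) b -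
        2 * fderiv ℝ (fiberEnergy L) q (0, connCoeff (canonicalSpray L) q q.2) b := by
    rw [show (q.2, (-2 : ℝ) • connCoeff (canonicalSpray L) q q.2) =
      (q.2, 0) + (-2 : ℝ) • ((0 : V), connCoeff (canonicalSpray L) q q.2) by simp, map_add,
      map_smul]
    simp
    ring
  have h5 : fderiv ℝ (fiberEnergy L) q (canonicalSpray L q) b =
      fderiv ℝ (fiberEnergy L) q (q.2, 0) b +
        fderiv ℝ (fiberEnergy L) q (0, (canonicalSpray L q).2) b := by
    conv_lhs => rw [hs]
    rw [map_add, _root_.add_apply]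
  have h6 : fderiv ℝ (fiberEnergy L) q (0, connCoeff (canonicalSpray L) q q.2 +
      (canonicalSpray L q).2) b =
      fderiv ℝ (fiberEnergy L) q (0, connCoeff (canonicalSpray L) q q.2) b +
        fderiv ℝ (fiberEnergy L) q (0, (canonicalSpray L q).2) b := by
    rw [← _root_.add_apply, ← map_add]
    simp
  rw [h6]
  rw [_root_.add_apply, h4] at h
  rw [_root_.add_apply, h5, ContinuousLinearMap.coe_snd', fiberDeriv_apply] at hg1
  simp only [map_zero, add_zero] at h1
  linarith

/-- Fibre derivative of `connCoeff_canonical`; it expresses `∇ʰδ = 0`. -/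
theorem berwaldCoeff_canonical {q : V × V} (hq : q ∈ slit U) (w : V) :
    berwaldCoeff (canonicalSpray L) q w q.2 = connCoeff (canonicalSpray L) q w := by
  have dN := hL.isSemispray.smooth_connCoeff.diffAt hL.isOpen_slit hq
  have dS := hL.smooth_canonicalSpray.diffAt hL.isOpen_slit hq
  have dS2 := hL.isSemispray.smooth_snd.diffAt hL.isOpen_slit hq
  have h : fderiv ℝ (fun p : V × V => connCoeff (canonicalSpray L) p p.2) q (0, w) =
      fderiv ℝ (fun p => -(canonicalSpray L p).2) q (0, w) := by
    rw [fderiv_congr_on hL.isOpen_slit (fun p hp => hL.connCoeff_canonical hp) hq]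
  rw [fderiv_clm_apply_apply dN differentiableAt_snd, fderiv_snd, fderiv_fun_neg,
    fderiv.snd dS] at h
  have h' : fderiv ℝ (connCoeff (canonicalSpray L)) q (0, w) =
    berwaldCoeff (canonicalSpray L) q w := rfl
  simp only [h', _root_.neg_apply, ContinuousLinearMap.comp_apply, hL.fderiv_spray hq,
    ContinuousLinearMap.coe_snd', neg_smul, neg_neg, two_smul] at h
  exact add_right_cancel h

/-- One more fibre derivative of the homogeneity relation. -/
theorem berwaldTensor_canonical {q : V × V} (hq : q ∈ slit U) (z w : V) :
    berwaldTensor (canonicalSpray L) q z w q.2 = 0 := by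
  have hS := hL.isSemispray
  have dN := hS.smooth_connCoeff.diffAt hL.isOpen_slit hq
  have dG := hS.smooth_berwaldCoeff.diffAt hL.isOpen_slit hq
  have h : fderiv ℝ (fun p : V × V => berwaldCoeff (canonicalSpray L) p w p.2) q (0, z) =
      fderiv ℝ (fun p => connCoeff (canonicalSpray L) p w) q (0, z) := by
    rw [fderiv_congr_on hL.isOpen_slit (fun p hp => hL.berwaldCoeff_canonical hp w) hq]
  rw [fderiv_clm_apply_apply (dG.clm_apply (differentiableAt_const w)) differentiableAt_snd,
    fderiv_snd, fderiv_const_apply dG, fderiv_const_apply dN] at h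
  have h' : fderiv ℝ (connCoeff (canonicalSpray L)) q (0, z) w =
    berwaldCoeff (canonicalSpray L) q z w := rfl
  rw [h', hS.berwaldCoeff_symm hq z w, ContinuousLinearMap.coe_snd'] at h
  exact add_eq_right.1 h

end IsLocalFinsler

end Local

/-! ### Landsberg and stretch tensors, and consequences of the p-Berwald condition. -/

section Local

variable {V : Type*} [NormedAddCommGroup V] [NormedSpace ℝ V]

theorem smooth_canonicalSection (U : Set V) : SmoothSection U canonicalSection := contDiffOn_snd

namespace IsLocalFinsler

variable {U : Set V} {L : V × V → ℝ} (hL : IsLocalFinsler U L)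

include hL

/-- In dimension at least `2`, non-degeneracy of the metric tensor forces a Finsler function to
have no zeros on the slit tangent bundle. -/
theorem ne_zero [FiniteDimensional ℝ V] (hdim : 2 ≤ Module.finrank ℝ V) {q : V × V}
    (hq : q ∈ slit U) : L q ≠ 0 := by
  intro h0
  have dL := hL.smooth.diffAt hL.isOpen_slit hq
  have dL' := (smoothOn_fiberDeriv hL.isOpen_slit hL.smooth).diffAt hL.isOpen_slit hq
  have h1 : ∀ p ∈ slit U, fiberEnergy L p = L p • fiberDeriv L p := fun p hp => by
    have h := ((hL.smooth.diffAt hL.isOpen_slit hp).hasFDerivAt.pow 2).const_mul (1 / 2 : ℝ)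
    have h' : fderiv ℝ (energy L) p = _ := h.fderiv
    ext w
    rw [fiberEnergy, fiberDeriv_apply, h']
    simp only [Nat.add_one_sub_one, pow_one, nsmul_eq_mul, Nat.cast_ofNat, _root_.smul_apply,
      smul_eq_mul, fiberDeriv_apply]
    ring
  -- At a zero of `L` the metric reduces to `L_y ⊗ L_y`, of rank at most one; a nonzero vector in
  -- the kernel of `L_y`, which exists in dimension at least two, contradicts non-degeneracy.
  have h2 : ∀ w u, fderiv ℝ (fiberEnergy L) q (0, w) u = fiberDeriv L q w * fiberDeriv L q u := by
    intro w u
    rw [fderiv_congr_on hL.isOpen_slit h1 hq, fderiv_fun_smul dL dL']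
    simp [h0, fiberDeriv_apply]
  obtain ⟨w, hw, hw0⟩ := (Submodule.ne_bot_iff _).1
    (LinearMap.ker_ne_bot_of_finrank_lt (f := (fiberDeriv L q : V →ₗ[ℝ] ℝ))
      (by rw [Module.finrank_self]; omega))
  refine hw0 (hL.eq_zero_of_fiberMetric hq fun u => ?_)
  have hw' : fiberDeriv L q w = 0 := hw
  rw [h2, hw', zero_mul]

theorem fiberEnergy_canonical_eq_sq {q : V × V} (hq : q ∈ slit U) :
    fiberEnergy L q q.2 = L q ^ 2 := by
  rw [hL.fiberEnergy_canonical hq, energy]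
  ring

variable {X Y Z T : V × V → V} (hX : SmoothSection U X) (hY : SmoothSection U Y)
  (hZ : SmoothSection U Z) (hT : SmoothSection U T)

include hX hY in
theorem metric_apply {q : V × V} (hq : q ∈ slit U) :
    metric L X Y q = fiberDeriv (fiberEnergy L) q (X q) (Y q) :=
  metric_eq hL.isOpen_slit hL.smooth hq (ContDiffOn.diffAt hX hL.isOpen_slit hq)
    (ContDiffOn.diffAt hY hL.isOpen_slit hq)

include hX in
theorem metric_canonicalSection {q : V × V} (hq : q ∈ slit U) :
    metric L X canonicalSection q = fiberEnergy L q (X q) := by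
  rw [hL.metric_apply hX (smooth_canonicalSection U) hq, fiberDeriv_apply, hL.fiberMetric_symm hq]
  exact hL.fiberMetric_canonical hq (X q)

include hX in
theorem orthProj_apply {q : V × V} (hq : q ∈ slit U) :
    orthProj L X q = X q - (fiberEnergy L q (X q) / L q ^ 2) • q.2 := by
  rw [orthProj, hL.metric_canonicalSection hX hq, hL.metric_canonicalSection (smooth_canonicalSection U) hq]
  simp only [canonicalSection]
  rw [hL.fiberEnergy_canonical_eq_sq hq]

include hX in
theorem smooth_orthProj (h0 : ∀ q ∈ slit U, L q ≠ 0) : SmoothSection U (orthProj L X) := by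
  have h : ContDiffOn ℝ ∞
      (fun q : V × V => X q - (fiberEnergy L q (X q) / L q ^ 2) • q.2) (slit U) :=
    hX.sub (((hL.smooth_fiberEnergy.clm_apply hX).div (hL.smooth.pow 2)
      fun q hq => pow_ne_zero 2 (h0 q hq)).smul contDiffOn_snd)
  exact h.congr fun q hq => hL.orthProj_apply hX hq

variable [FiniteDimensional ℝ V]

include hX hY hZ in
/-- The Landsberg tensor is `-½ g(𝐁(X, Y) Z, δ)`. -/
theorem landsberg_apply {q : V × V} (hq : q ∈ slit U) :
    landsberg L X Y Z q =
      -(1 / 2) * fiberEnergy L q (berwaldTensor (canonicalSpray L) q (X q) (Y q) (Z q)) := by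
  have hS := hL.isSemispray
  have dY := ContDiffOn.diffAt hY hL.isOpen_slit hq
  have dZ := ContDiffOn.diffAt hZ hL.isOpen_slit hq
  have dg := hL.smooth_fiberMetric.diffAt hL.isOpen_slit hq
  have h1 : along (horLift (canonicalSpray L) X) (metric L Y Z) q =
      fderiv ℝ (metric L Y Z) q (hor (canonicalSpray L) q (X q)) := rfl
  rw [landsberg, hDeriv₂, h1,
    fderiv_congr_on hL.isOpen_slit (fun p hp => hL.metric_apply hY hZ hp) hq,
    hL.metric_apply (hS.smooth_hDeriv hX hY) hZ hq, hL.metric_apply hY (hS.smooth_hDeriv hX hZ) hq,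
    hS.hDeriv_eq hX hY hq, hS.hDeriv_eq hX hZ hq, fderiv_clm_apply_apply (dg.clm_apply dY) dZ,
    fderiv_clm_apply_apply dg dY, _root_.add_apply, hS.hor_eq hq, hL.fderiv_fiberMetric_hor hq,
    hS.berwaldTensor_symm_left hq (X q)]
  simp only [map_add, _root_.add_apply]
  ring

include hX hY hZ hT in
theorem hDeriv₃_landsberg {q : V × V} (hq : q ∈ slit U) :
    hDeriv₃ (canonicalSpray L) (landsberg L) X Y Z T q =
      -(1 / 2) * fiberEnergy L q
        (berwaldTensorDeriv (canonicalSpray L) q (X q) (Y q) (Z q) (T q)) := by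
  have hS := hL.isSemispray
  have dY := ContDiffOn.diffAt hY hL.isOpen_slit hq
  have dZ := ContDiffOn.diffAt hZ hL.isOpen_slit hq
  have dT := ContDiffOn.diffAt hT hL.isOpen_slit hq
  have dB := hS.smooth_berwaldTensor.diffAt hL.isOpen_slit hq
  have dBYZT := ((dB.clm_apply dY).clm_apply dZ).clm_apply dT
  have dθ := hL.smooth_fiberEnergy.diffAt hL.isOpen_slit hq
  have h1 : along (horLift (canonicalSpray L) X) (landsberg L Y Z T) q =
      fderiv ℝ (landsberg L Y Z T) q (hor (canonicalSpray L) q (X q)) := rfl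
  rw [hDeriv₃, h1, fderiv_congr_on hL.isOpen_slit (fun p hp => hL.landsberg_apply hY hZ hT hp) hq,
    hL.landsberg_apply (hS.smooth_hDeriv hX hY) hZ hT hq,
    hL.landsberg_apply hY (hS.smooth_hDeriv hX hZ) hT hq,
    hL.landsberg_apply hY hZ (hS.smooth_hDeriv hX hT) hq,
    hS.hDeriv_eq hX hY hq, hS.hDeriv_eq hX hZ hq, hS.hDeriv_eq hX hT hq,
    fderiv_const_mul (dθ.clm_apply dBYZT), _root_.smul_apply,
    fderiv_clm_apply_apply dθ dBYZT, fderiv_clm_apply_apply ((dB.clm_apply dY).clm_apply dZ) dT,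
    fderiv_clm_apply_apply (dB.clm_apply dY) dZ, fderiv_clm_apply_apply dB dY, hS.hor_eq hq,
    hL.fderiv_fiberEnergy_hor hq, berwaldTensorDeriv]
  simp only [map_add, map_sub, _root_.add_apply, smul_eq_mul]
  ring

include hX hY hZ hT in
/-- The stretch tensor is the `δ`-component of the vertical differential of the affine
curvature. -/
theorem stretch_apply {q : V × V} (hq : q ∈ slit U) :
    stretch L Z Y X T q =
      fiberEnergy L q (vDerivAffineCurvature (canonicalSpray L) X Y Z T q) := by
  have hS := hL.isSemispray
  rw [stretch, hL.hDeriv₃_landsberg hZ hY hX hT hq, hL.hDeriv₃_landsberg hY hZ hX hT hq,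
    hS.vDerivAffineCurvature_eq hX hY hZ hT hq, map_sub,
    hS.berwaldTensorDeriv_symm_left hq (Y q) (Z q), hS.berwaldTensorDeriv_symm_left hq (Z q) (Y q)]
  ring

theorem berwaldTensor_sub_canonical {q : V × V} (hq : q ∈ slit U) (x y z : V) (a b c : ℝ) :
    berwaldTensor (canonicalSpray L) q (x - a • q.2) (y - b • q.2) (z - c • q.2) =
      berwaldTensor (canonicalSpray L) q x y z := by
  have hS := hL.isSemispray
  have h2 : ∀ x y, berwaldTensor (canonicalSpray L) q x q.2 y = 0 := fun x y => by
    rw [hS.berwaldTensor_symm_right hq, hL.berwaldTensor_canonical hq]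
  have h1 : ∀ x y, berwaldTensor (canonicalSpray L) q q.2 x y = 0 := fun x y => by
    rw [hS.berwaldTensor_symm_left hq, h2]
  simp [h1, h2, hL.berwaldTensor_canonical hq]

variable (h0 : ∀ q ∈ slit U, L q ≠ 0)
  (hB : ∀ X Y Z : V × V → V, SmoothSection U X → SmoothSection U Y → SmoothSection U Z →
    ∀ q ∈ slit U, projectedBerwaldCurvature L X Y Z q = 0)

include h0 hB

/-- Projecting the arguments has no effect by `berwaldTensor_sub_canonical`, so only the outer `𝐩`
matters, and its kernel is spanned by `δ`. -/
theorem berwaldTensor_eq_of_projected {q : V × V} (hq : q ∈ slit U) (x y z : V) :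
    L q ^ 2 • berwaldTensor (canonicalSpray L) q x y z =
      fiberEnergy L q (berwaldTensor (canonicalSpray L) q x y z) • q.2 := by
  have hS := hL.isSemispray
  have hc : ∀ v : V, SmoothSection U (fun _ => v) := fun v => contDiffOn_const
  have hp : ∀ v : V, SmoothSection U (orthProj L fun _ => v) := fun v =>
    hL.smooth_orthProj (hc v) h0
  have h1 : ∀ p ∈ slit U, berwaldCurvature (canonicalSpray L) (orthProj L fun _ => x)
      (orthProj L fun _ => y) (orthProj L fun _ => z) p =
        berwaldTensor (canonicalSpray L) p x y z := fun p hp' => by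
    rw [hS.berwaldCurvature_eq (hp x) (hp y) (hp z) hp', hL.orthProj_apply (hc x) hp',
      hL.orthProj_apply (hc y) hp', hL.orthProj_apply (hc z) hp',
      hL.berwaldTensor_sub_canonical hp']
  have h2 : SmoothSection U (berwaldCurvature (canonicalSpray L) (orthProj L fun _ => x)
      (orthProj L fun _ => y) (orthProj L fun _ => z)) :=
    ContDiffOn.congr (((hS.smooth_berwaldTensor.clm_apply contDiffOn_const).clm_apply
      contDiffOn_const).clm_apply contDiffOn_const) h1
  have h3 := hB _ _ _ (hc x) (hc y) (hc z) q hq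
  rw [projectedBerwaldCurvature, hL.orthProj_apply h2 hq, h1 q hq, sub_eq_zero] at h3
  rw [h3, map_smul, hL.fiberEnergy_canonical_eq_sq hq, smul_smul, smul_eq_mul]
  congr 1
  ring

/-- If the projected Berwald curvature vanishes, then the h-Berwald differential of the Berwald
curvature takes values in the multiples of the canonical section. -/
theorem berwaldTensorDeriv_eq_of_projected {q : V × V} (hq : q ∈ slit U) (w x y z : V) :
    L q ^ 2 • berwaldTensorDeriv (canonicalSpray L) q w x y z =
      fiberEnergy L q (berwaldTensorDeriv (canonicalSpray L) q w x y z) • q.2 := by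
  have hS := hL.isSemispray
  have hb := fun x y z => hL.berwaldTensor_eq_of_projected h0 hB hq x y z
  have dE := hL.smooth_energy.diffAt hL.isOpen_slit hq
  have dθ := hL.smooth_fiberEnergy.diffAt hL.isOpen_slit hq
  have dB : DifferentiableAt ℝ (fun p => berwaldTensor (canonicalSpray L) p x y z) q :=
    (((hS.smooth_berwaldTensor.diffAt hL.isOpen_slit hq).clm_apply
      (differentiableAt_const x)).clm_apply (differentiableAt_const y)).clm_apply
        (differentiableAt_const z)
  -- The pointwise relation is differentiated horizontally with constant `x`, `y`, `z`. Writing `L²`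
  -- as `2E` makes the derivative of the factor vanish by `fderiv_energy_hor`.
  have h : fderiv ℝ (fun p => (2 * energy L p) • berwaldTensor (canonicalSpray L) p x y z) q
      (w, -connCoeff (canonicalSpray L) q w) =
      fderiv ℝ (fun p => fiberEnergy L p (berwaldTensor (canonicalSpray L) p x y z) • p.2) q
        (w, -connCoeff (canonicalSpray L) q w) := by
    rw [fderiv_congr_on hL.isOpen_slit (fun p hp => ?_) hq]
    rw [← hL.berwaldTensor_eq_of_projected h0 hB hp, energy]
    congr 1
    ring
  rw [fderiv_fun_smul (dE.const_mul 2) dB,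
    fderiv_fun_smul (dθ.clm_apply dB) differentiableAt_snd, fderiv_const_mul dE, fderiv_snd] at h
  simp only [_root_.add_apply, _root_.smul_apply, ContinuousLinearMap.smulRight_apply,
    hL.fderiv_energy_hor hq, ContinuousLinearMap.coe_snd', smul_zero, zero_smul, add_zero] at h
  rw [fderiv_clm_apply_apply dθ dB, hS.fderiv_berwaldTensor_apply hq,
    hL.fderiv_fiberEnergy_hor hq, show 2 * energy L q = L q ^ 2 by rw [energy]; ring] at h
  -- This connection term compensates the derivative of `δ`, which is the content of `∇ʰδ = 0`.
  have h4 : L q ^ 2 • berwaldCoeff (canonicalSpray L) q w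
        (berwaldTensor (canonicalSpray L) q x y z) =
      fiberEnergy L q (berwaldTensor (canonicalSpray L) q x y z) •
        connCoeff (canonicalSpray L) q w := by
    rw [← map_smul, hb, map_smul, hL.berwaldCoeff_canonical hq]
  simp only [berwaldTensorDeriv, smul_sub, smul_add, map_sub, map_add, sub_smul, hb, h, h4]
  module

theorem vDerivAffineCurvature_eq_of_projected {X Y Z T : V × V → V} (hX : SmoothSection U X)
    (hY : SmoothSection U Y) (hZ : SmoothSection U Z) (hT : SmoothSection U T) {q : V × V}
    (hq : q ∈ slit U) :
    vDerivAffineCurvature (canonicalSpray L) X Y Z T q =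
      (1 / L q ^ 2 * stretch L Z Y X T q) • canonicalSection q := by
  have h : L q ^ 2 • vDerivAffineCurvature (canonicalSpray L) X Y Z T q =
      stretch L Z Y X T q • q.2 := by
    rw [hL.stretch_apply hX hY hZ hT hq,
      hL.isSemispray.vDerivAffineCurvature_eq hX hY hZ hT hq, smul_sub,
      hL.berwaldTensorDeriv_eq_of_projected h0 hB hq,
      hL.berwaldTensorDeriv_eq_of_projected h0 hB hq, map_sub, sub_smul]
  rw [mul_smul, canonicalSection, ← h, smul_smul, one_div,
    inv_mul_cancel₀ (pow_ne_zero 2 (h0 q hq)), one_smul]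

end IsLocalFinsler

end Local

/-! ### From charts to the manifold. -/

section Manifold

variable {V : Type*} [NormedAddCommGroup V] [NormedSpace ℝ V]
  {M : Type*} [TopologicalSpace M] [ChartedSpace V M] [IsManifold 𝓘(ℝ, V) ∞ M]

/-- The chart expression is `F` composed with the tangent map of `e.symm`, which is fibrewise
injective and so preserves nonzero vectors. -/
theorem smooth_inChart {F : TangentBundle 𝓘(ℝ, V) M → ℝ} (hF : IsFinslerFunction F)
    {e : OpenPartialHomeomorph M V} (he : e ∈ IsManifold.maximalAtlas 𝓘(ℝ, V) ∞ M) :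
    ContDiffOn ℝ ∞ (inChart F e) (slit e.target) := by
  have h1 : ContMDiffOn 𝓘(ℝ, V) 𝓘(ℝ, V) ∞ e.symm e.target := contMDiffOn_symm_of_mem_maximalAtlas he
  have h2 := h1.contMDiffOn_tangentMapWithin (m := ∞) (by simp) e.open_target.uniqueMDiffOn
  have h3 : ContMDiff 𝓘(ℝ, V × V) 𝓘(ℝ, V).tangent ∞
      (fun q : V × V => (⟨q.1, q.2⟩ : TangentBundle 𝓘(ℝ, V) V)) := by
    intro q
    rw [Bundle.contMDiffAt_totalSpace]
    refine ⟨contMDiff_iff_contDiff.2 contDiff_fst q, ?_⟩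
    simpa using contMDiff_iff_contDiff.2 contDiff_snd q
  rw [← contMDiffOn_iff_contDiffOn]
  have h4 := hF.smooth.comp (h2.comp h3.contMDiffOn (s := slit e.target) fun q hq => hq.1) ?_
  · refine h4.congr fun q hq => ?_
    simp only [inChart, Function.comp_apply, tangentMapWithin]
    rw [mfderivWithin_of_isOpen e.open_target hq.1]
  · intro q hq
    simp only [Set.mem_preimage, Set.mem_ofPred_eq, Function.comp_apply, tangentMapWithin]
    rw [mfderivWithin_of_isOpen e.open_target hq.1]
    have hd : e.symm.MDifferentiable 𝓘(ℝ, V) 𝓘(ℝ, V) :=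
      ⟨h1.mdifferentiableOn (by simp),
        (contMDiffOn_of_mem_maximalAtlas he).mdifferentiableOn (by simp)⟩
    exact (map_ne_zero_iff _ (hd.mfderiv_injective hq.1)).2 hq.2

theorem isLocalFinsler_inChart {F : TangentBundle 𝓘(ℝ, V) M → ℝ} (hF : IsFinslerFunction F)
    {e : OpenPartialHomeomorph M V} (he : e ∈ IsManifold.maximalAtlas 𝓘(ℝ, V) ∞ M) :
    IsLocalFinsler e.target (inChart F e) where
  isOpen := e.open_target
  smooth := smooth_inChart hF he
  homogeneous q _ c hc := by
    simp only [inChart]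
    rw [← hF.homogeneous _ _ _ hc.le]
    exact congrArg (fun w => F ⟨e.symm q.1, w⟩)
      ((mfderiv 𝓘(ℝ, V) 𝓘(ℝ, V) e.symm q.1).map_smul c q.2)
  nondegenerate := hF.nondegenerate e he

end Manifold
end Finsler
end

theorem mainTheorem7 {V : Type*} [NormedAddCommGroup V] [NormedSpace ℝ V] [FiniteDimensional ℝ V]
    (hdim : 2 ≤ Module.finrank ℝ V)
    {M : Type*} [TopologicalSpace M] [T2Space M] [SecondCountableTopology M] [ConnectedSpace M]
    [ChartedSpace V M] [IsManifold 𝓘(ℝ, V) ∞ M]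
    (F : TangentBundle 𝓘(ℝ, V) M → ℝ) (hF : Finsler.IsFinslerFunction F)
    (hB : Finsler.IsPBerwald F) :
    (Finsler.IsRQuadratic F ↔ Finsler.HasVanishingStretch F) ∧
    ∀ e ∈ IsManifold.maximalAtlas 𝓘(ℝ, V) ∞ M, ∀ X Y Z U : V × V → V,
      Finsler.SmoothSection e.target X → Finsler.SmoothSection e.target Y →
      Finsler.SmoothSection e.target Z → Finsler.SmoothSection e.target U →
      ∀ q ∈ Finsler.slit e.target,
        Finsler.vDerivAffineCurvature (Finsler.canonicalSpray (Finsler.inChart F e)) X Y Z U q =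
          (1 / Finsler.inChart F e q ^ 2 * Finsler.stretch (Finsler.inChart F e) Z Y X U q) •
            Finsler.canonicalSection q := by
  have hlocal := fun e (he : e ∈ IsManifold.maximalAtlas 𝓘(ℝ, V) ∞ M) =>
    Finsler.isLocalFinsler_inChart hF he
  have key : ∀ e ∈ IsManifold.maximalAtlas 𝓘(ℝ, V) ∞ M, ∀ X Y Z U : V × V → V,
      Finsler.SmoothSection e.target X → Finsler.SmoothSection e.target Y →
      Finsler.SmoothSection e.target Z → Finsler.SmoothSection e.target U →
      ∀ q ∈ Finsler.slit e.target,
        Finsler.vDerivAffineCurvature (Finsler.canonicalSpray (Finsler.inChart F e)) X Y Z U q =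
          (1 / Finsler.inChart F e q ^ 2 * Finsler.stretch (Finsler.inChart F e) Z Y X U q) •
            Finsler.canonicalSection q := fun e he X Y Z U hX hY hZ hU q hq =>
    (hlocal e he).vDerivAffineCurvature_eq_of_projected
      (fun p hp => (hlocal e he).ne_zero hdim hp) (hB e he) hX hY hZ hU hq
  refine ⟨⟨fun h e he X Y Z U hX hY hZ hU q hq => ?_,
    fun h e he X Y Z U hX hY hZ hU q hq => ?_⟩, key⟩
  -- Exchanging the first and third arguments is an involution, so the formula at `Z, Y, X, U`
  -- involves the stretch at `X, Y, Z, U`.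
  · have h1 := key e he Z Y X U hZ hY hX hU q hq
    rw [h e he Z Y X U hZ hY hX hU q hq] at h1
    have h2 := smul_eq_zero.1 h1.symm
    have h3 : 1 / Finsler.inChart F e q ^ 2 ≠ 0 :=
      one_div_ne_zero (pow_ne_zero 2 ((hlocal e he).ne_zero hdim hq))
    exact (mul_eq_zero.1 (h2.resolve_right hq.2)).resolve_left h3
  · rw [key e he X Y Z U hX hY hZ hU q hq, h e he Z Y X U hZ hY hX hU q hq, mul_zero, zero_smul]
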